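/- Let $\mathcal S,\mathcal A$ be finite sets with $|\mathcal A|\ge 2$, and consider an infinite-horizon discounted Markov decision process with state space $\mathcal S$, action space $\mathcal A$, known transition probabilities $p(s'|s,a)$, discount rate $\gamma\in(0,1)$ and initial state distribution $\rho$, but unknown reward $r:\mathcal S\times\mathcal A\to\mathbb R$. For a deterministic policy $\pi:\mathcal S\to\mathcal A$ let $V^\pi_r(s)$ be its expected discounted return from $s$, $V^*_r(s)=\max_\pi V^\pi_r(s)$, $Q^*_r(s,a)=r(s,a)+\gamma\sum_{s'}p(s'|s,a)V^*_r(s')$, and let $R^\pi_r=\sum_s\rho(s)\,(V^*_r(s)-V^\pi_r(s))$ be its regret. Let $\epsilon>0$, $\delta\in(0,\frac12]$, $\beta>0$, and let the prior be any Borel probability measure on $\mathbb R^{\mathcal S\times\mathcal A}$. For $s\in\mathcal S$ and $a,b\in\mathcal A$ let $E_{s,b,a}$ be the ternary variable equal to "correct" if $\max\{0,Q^*_r(s,a)-Q^*_r(s,b)\}=0$, "approximately correct" if this quantity lies in $(0,\epsilon(1-\gamma))$, and "not correct" if it is at least $\epsilon(1-\gamma)$. Put $E=(E_{s,b,a})_{s,b,a}$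 and, for a policy $\pi$, $E^{\pi}=(E_{s,\pi(s),a})_{s,a}$. The learner proceeds in steps. The true reward $r$ is drawn from the prior. Given the data $\mathcal D_n$ (the first $n$ demonstrations) and the posterior $p(r|\mathcal D_n)$, it takes an apprentice policy with $\pi^{\mathrm A}_n(s)\in\arg\max_a\mathbb P[\,a\text{ maximizes }Q^*_r(s,\cdot)\mid\mathcal D_n]$ for all $s$, and queries an initial state $s_0\in\arg\max_{s}I(\tau;E^{\pi^{\mathrm A}_n}\mid s_0=s,\mathcal D_n)$, where all ties may be broken arbitrarily. It then observes a demonstration $\tau$ from $s_0$: a trajectory with a fixed number $T+1\ge1$ of state-action pairs ($T=0$ being a single-state query), whose actions are drawn from the Boltzmann-rational expert policy $\pi^{\mathrm E}_r(a|s)=e^{\beta Q^*_r(s,a)}/\sum_{a'}e^{\beta Q^*_r(s,a')}$ and whose states follow $p$. The PAC condition holds at step $n$ if some deterministic policy $\pi$ satisfies $\mathbb P[R^\pi_r\ge\epsilon\mid\mathcal D_n]\le\delta$; let $N\in\{0,1,\dots\}\cup\{\infty\}$ be the first step at which it holds. Put $$\mathrm{EIG}_{\min}(\epsilon,\delta)=\frac{\delta\,(1-e^{-\beta(1-\gamma)\epsilon})^2}{4|\mathcal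 A|^2(|\mathcal A|-1)^3|\mathcal S|}.$$ Then, for every prior, $$\mathbb E[N]\;\le\;\frac{\log(3)\,|\mathcal S||\mathcal A|^2}{\mathrm{EIG}_{\min}(\epsilon,\delta)}=\frac{4\log(3)|\mathcal A|^4(|\mathcal A|-1)^3|\mathcal S|^2}{\delta(1-e^{-\beta(1-\gamma)\epsilon})^2}\;\le\;\frac{4\log(3)|\mathcal A|^4(|\mathcal A|-1)^3|\mathcal S|^2}{\delta e^{-\beta(1-\gamma)\epsilon}(1-e^{-\beta(1-\gamma)\epsilon/2})^2},$$ and the entropy (in nats) of $E$ under the prior, a collection of $|\mathcal S||\mathcal A|^2$ ternary variables, is at most $\log(3)|\mathcal S||\mathcal A|^2$. -/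

import Mathlib

open MeasureTheory
open scoped ENNReal

noncomputable section

namespace ActiveIRL

/-- Reward functions; the prior is a probability measure on this (finite-dimensional) space. -/
abbrev Reward (S A : Type*) := S × A → ℝ

/-- A finite infinite-horizon discounted Markov decision process without its reward. -/
structure MDP (S A : Type*) [Fintype S] where
  /-- `trans s a s'` is the probability of moving from `s` to `s'` under action `a`. -/
  trans : S → A → S → ℝ
  trans_nonneg : ∀ s a s', 0 ≤ trans s a s'
  trans_sum : ∀ s a, ∑ s', trans s a s' = 1
  /-- The initial state distribution. -/
  init : S → ℝ
  init_nonneg : ∀ s, 0 ≤ init s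
  init_sum : ∑ s, init s = 1
  /-- The discount rate. -/
  disc : ℝ
  disc_pos : 0 < disc
  disc_lt_one : disc < 1

/-- The three levels of the discretized immediate regret. -/
inductive Level
  | correct
  | approx
  | notCorrect
  deriving DecidableEq

instance : Fintype Level where
  elems := {Level.correct, Level.approx, Level.notCorrect}
  complete := fun x => by cases x <;> simp

/-- A demonstration: a trajectory of `T + 1` state-action pairs.
For `T = 0` this is a single-state annotation. -/
abbrev Demo (S A : Type*) (T : ℕ) := Fin (T + 1) → S × A

/-- Shannon entropy (natural logarithm) of a probability vector. -/
def entropy {X : Type*} [Fintype X] (p : X → ℝ) : ℝ :=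
  ∑ x, Real.negMulLog (p x)

/-- Mutual information (natural logarithm) of two finite-valued random variables with joint
probabilities `q`. Terms with `q x y = 0` vanish. -/
def mutualInfo {X Y : Type*} [Fintype X] [Fintype Y] (q : X → Y → ℝ) : ℝ :=
  ∑ x, ∑ y, q x y * Real.log (q x y / ((∑ y', q x y') * ∑ x', q x' y))

section

variable {S A : Type*} [Fintype S] [DecidableEq S] [Fintype A] [DecidableEq A]

namespace MDP

variable (M : MDP S A)

/-- The state transition matrix of a deterministic policy. -/
def policyMatrix (π : S → A) : Matrix S S ℝ :=
  Matrix.of fun s s' => M.trans s (π s) s'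

/-- `V^π_r(s)`: the expected discounted return `∑ₜ γᵗ E[r(sₜ, π(sₜ)) | s₀ = s]`. -/
def value (r : Reward S A) (π : S → A) (s : S) : ℝ :=
  ∑' t : ℕ, M.disc ^ t * ∑ s', (M.policyMatrix π ^ t) s s' * r (s', π s')

/-- `V^*_r(s)`: the optimal value (a maximum over the finitely many policies). -/
def optValue (r : Reward S A) (s : S) : ℝ :=
  ⨆ π : S → A, M.value r π s

/-- `Q^*_r(s, a)`. -/
def optQ (r : Reward S A) (s : S) (a : A) : ℝ :=
  r (s, a) + M.disc * ∑ s', M.trans s a s' * M.optValue r s'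

/-- `R^π_r`: the expected regret of `π` under the initial state distribution. -/
def regret (r : Reward S A) (π : S → A) : ℝ :=
  ∑ s, M.init s * (M.optValue r s - M.value r π s)

/-- Action `a` is optimal in state `s` under reward `r`. -/
def IsOptAction (r : Reward S A) (s : S) (a : A) : Prop :=
  ∀ a', M.optQ r s a' ≤ M.optQ r s a

/-- The Boltzmann-rational expert policy for reward `r`. -/
def expert (β : ℝ) (r : Reward S A) (s : S) (a : A) : ℝ :=
  Real.exp (β * M.optQ r s a) / ∑ a', Real.exp (β * M.optQ r s a')

/-- Likelihood under reward `r` of a demonstration, given its initial state. -/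
def likelihood (β : ℝ) {T : ℕ} (r : Reward S A) (d : Demo S A T) : ℝ :=
  (∏ t, M.expert β r (d t).1 (d t).2) *
    ∏ t : Fin T, M.trans (d t.castSucc).1 (d t.castSucc).2 (d t.succ).1

/-- Probability that the expert with reward `r`, queried at `s₀`, produces the demonstration. -/
def demoProb (β : ℝ) {T : ℕ} (r : Reward S A) (s₀ : S) (d : Demo S A T) : ℝ :=
  if (d 0).1 = s₀ then M.likelihood β r d else 0

/-- Likelihood of a data set of demonstrations. -/
def dataLikelihood (β : ℝ) {T : ℕ} (r : Reward S A) (D : List (Demo S A T)) : ℝ :=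
  (D.map (M.likelihood β r)).prod

/-- The posterior over rewards given the data `D`, by Bayes' rule. -/
def posterior (β : ℝ) (μ : Measure (Reward S A)) {T : ℕ} (D : List (Demo S A T)) :
    Measure (Reward S A) :=
  (∫⁻ r, ENNReal.ofReal (M.dataLikelihood β r D) ∂μ)⁻¹ •
    μ.withDensity fun r => ENNReal.ofReal (M.dataLikelihood β r D)

/-- Immediate regret, in state `s`, of taking action `b` relative to the alternative `a`. -/
def immRegret (r : Reward S A) (s : S) (b a : A) : ℝ :=
  max 0 (M.optQ r s a - M.optQ r s b)

open Classical in
/-- The aggregate variable `E`, consisting of `|S||A|²` ternary variables: entry `(s, b, a)` is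
the discretized regret of taking `b` in state `s`, relative to `a`. -/
def regretLevels (ε : ℝ) (r : Reward S A) : S × A × A → Level := fun x =>
  if M.immRegret r x.1 x.2.1 x.2.2 = 0 then Level.correct
  else if M.immRegret r x.1 x.2.1 x.2.2 < ε * (1 - M.disc) then Level.approx
  else Level.notCorrect

/-- The variable `E^π` of a given policy `π`. -/
def policyLevels (ε : ℝ) (π : S → A) (r : Reward S A) : S × A → Level := fun x =>
  M.regretLevels ε r (x.1, π x.1, x.2)

/-- The acquisition function `I(τ; E^π | s₀, D)`. -/
def acquisition (β ε : ℝ) (μ : Measure (Reward S A)) {T : ℕ} (D : List (Demo S A T))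
    (π : S → A) (s₀ : S) : ℝ :=
  mutualInfo fun (d : Demo S A T) (e : S × A → Level) =>
    ∫ r in {r | M.policyLevels ε π r = e}, M.demoProb β r s₀ d ∂(M.posterior β μ D)

/-- The PAC condition under data `D`: some policy has regret at least `ε` with posterior
probability at most `δ`. -/
def PAC (β ε δ : ℝ) (μ : Measure (Reward S A)) {T : ℕ} (D : List (Demo S A T)) : Prop :=
  ∃ π : S → A, (M.posterior β μ D).real {r | ε ≤ M.regret r π} ≤ δ

/-- A rule for choosing the intermediate apprentice policy from the data: in each state it
maximizes the posterior probability of the action being optimal (ties broken arbitrarily). -/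
def IsApprenticeRule (β : ℝ) (μ : Measure (Reward S A)) {T : ℕ}
    (app : List (Demo S A T) → S → A) : Prop :=
  ∀ D s a, (M.posterior β μ D).real {r | M.IsOptAction r s a} ≤
    (M.posterior β μ D).real {r | M.IsOptAction r s (app D s)}

/-- A query rule maximizing the acquisition function (ties broken arbitrarily). -/
def IsQueryRule (β ε : ℝ) (μ : Measure (Reward S A)) {T : ℕ}
    (app : List (Demo S A T) → S → A) (query : List (Demo S A T) → S) : Prop :=
  ∀ D s, M.acquisition β ε μ D (app D) s ≤ M.acquisition β ε μ D (app D) (query D)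

end MDP

/-- The data set after `n` steps. -/
def history {Ω : Type*} {T : ℕ} (demo : ℕ → Ω → Demo S A T) (n : ℕ) (ω : Ω) :
    List (Demo S A T) :=
  List.ofFn fun i : Fin n => demo i ω

/-- Active learning as a random process: the true reward `R` has law `μ`, and conditionally on
`R` and on the first `n` demonstrations, the next one is produced by the expert for reward `R`
from the queried initial state. -/
structure IsLearningProcess (M : MDP S A) (β : ℝ) (μ : Measure (Reward S A)) {T : ℕ}
    (query : List (Demo S A T) → S) {Ω : Type*} [MeasurableSpace Ω] (P : Measure Ω)
    (R : Ω → Reward S A) (demo : ℕ → Ω → Demo S A T) : Prop where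
  measurable_reward : Measurable R
  measurable_demo : ∀ n d, MeasurableSet {ω | demo n ω = d}
  reward_law : P.map R = μ
  demo_law : ∀ (n : ℕ) (B : Set (Reward S A)) (D : List (Demo S A T)) (d : Demo S A T),
    MeasurableSet B →
      P {ω | R ω ∈ B ∧ history demo n ω = D ∧ demo n ω = d} =
        ∫⁻ ω in {ω | R ω ∈ B ∧ history demo n ω = D},
          ENNReal.ofReal (M.demoProb β (R ω) (query D) d) ∂P

/-- The number of steps until the PAC condition is first met (`∞` if it never is). -/
def numSteps (M : MDP S A) (β ε δ : ℝ) (μ : Measure (Reward S A)) {T : ℕ} {Ω : Type*}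
    (demo : ℕ → Ω → Demo S A T) (ω : Ω) : ℝ≥0∞ :=
  ⨅ (n : ℕ) (_ : M.PAC β ε δ μ (history demo n ω)), (n : ℝ≥0∞)

/-- The minimal expected information gain `EIG_min(ε, δ)`. -/
def eigMin (M : MDP S A) (β ε δ : ℝ) : ℝ :=
  δ * (1 - Real.exp (-(β * (1 - M.disc) * ε))) ^ 2 /
    (4 * (Fintype.card A : ℝ) ^ 2 * ((Fintype.card A : ℝ) - 1) ^ 3 * (Fintype.card S : ℝ))

end

end ActiveIRL

end

namespace ActiveIRL

/-! ### Finite information theory -/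

/-- A rational lower bound for the logarithm, sharp to third order at `1`. -/
theorem rational_le_log {t : ℝ} (ht : 0 < t) :
    (t - 1) * (5 * t + 1) / (2 * t * (t + 2)) ≤ Real.log t := by
  set L : ℝ → ℝ := fun t => Real.log t - (t - 1) * (5 * t + 1) / (2 * t * (t + 2)) with hL
  have hder : ∀ x : ℝ, 0 < x → HasDerivAt L ((x - 1) ^ 3 / (x ^ 2 * (x + 2) ^ 2)) x := by
    intro x hx
    have h1 : HasDerivAt (fun t : ℝ => (t - 1) * (5 * t + 1))
        (1 * (5 * x + 1) + (x - 1) * (5 * 1)) x :=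
      ((hasDerivAt_id x).sub_const 1).mul (((hasDerivAt_id x).const_mul 5).add_const 1)
    have h2 : HasDerivAt (fun t : ℝ => 2 * t * (t + 2)) (2 * 1 * (x + 2) + 2 * x * 1) x :=
      ((hasDerivAt_id x).const_mul 2).mul ((hasDerivAt_id x).add_const 2)
    have h3 := (Real.hasDerivAt_log hx.ne').sub (h1.div h2 (by positivity))
    refine h3.congr_deriv ?_
    field_simp
    ring
  have hcont : ∀ s : Set ℝ, s ⊆ Set.Ioi 0 → ContinuousOn L s := fun s hs x hx =>
    (hder x (hs hx)).continuousAt.continuousWithinAt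
  have h1 : L 1 = 0 := by simp [hL]
  have key : 0 ≤ L t := by
    rcases le_total 1 t with h | h
    · have hm : MonotoneOn L (Set.Ici 1) := by
        refine monotoneOn_of_deriv_nonneg (convex_Ici 1)
          (hcont _ fun x hx => Set.mem_Ioi.2 (one_pos.trans_le (Set.mem_Ici.1 hx))) ?_ ?_
        · intro x hx
          rw [interior_Ici] at hx
          exact (hder x (one_pos.trans hx)).differentiableAt.differentiableWithinAt
        · intro x hx
          rw [interior_Ici] at hx
          have hx' : 0 ≤ x - 1 := sub_nonneg.2 hx.le
          rw [(hder x (one_pos.trans hx)).deriv]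
          positivity
      rw [← h1]
      exact hm (Set.mem_Ici.2 le_rfl) (Set.mem_Ici.2 h) h
    · have hm : AntitoneOn L (Set.Ioc 0 1) := by
        refine antitoneOn_of_deriv_nonpos (convex_Ioc 0 1)
          (hcont _ fun x hx => hx.1) ?_ ?_
        · intro x hx
          rw [interior_Ioc] at hx
          exact (hder x hx.1).differentiableAt.differentiableWithinAt
        · intro x hx
          rw [interior_Ioc] at hx
          rw [(hder x hx.1).deriv]
          have hx' : x - 1 ≤ 0 := sub_nonpos.2 hx.2.le
          have h3 : (x - 1) ^ 3 ≤ 0 := by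
            have := pow_nonneg (neg_nonneg.2 hx') 3
            nlinarith
          exact div_nonpos_of_nonpos_of_nonneg h3 (by positivity)
      rw [← h1]
      exact hm ⟨ht, h⟩ ⟨one_pos, le_rfl⟩ h
  simpa [hL] using key

/-- The pointwise estimate behind Pinsker's inequality. -/
theorem sq_sub_le_mul_log {a b : ℝ} (ha : 0 ≤ a) (hb : 0 ≤ b) (hab : b = 0 → a = 0) :
    (a - b) ^ 2 ≤ (2 / 3 * (a + 2 * b)) * (a * Real.log (a / b) - a + b) := by
  rcases hb.eq_or_lt with h | hb
  · simp [hab h.symm, ← h]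
  rcases ha.eq_or_lt with h | ha
  · rw [← h]; simp; nlinarith
  have ht : 0 < a / b := div_pos ha hb
  have h := rational_le_log ht
  have h2 : (a - b) * (5 * a + b) / (2 * (a + 2 * b)) ≤ a * Real.log (a / b) := by
    refine le_trans (le_of_eq ?_) (mul_le_mul_of_nonneg_left h ha.le)
    field_simp
  have h3 : (a - b) ^ 2 = (2 / 3 * (a + 2 * b)) *
      ((a - b) * (5 * a + b) / (2 * (a + 2 * b)) - a + b) := by
    field_simp
    ring
  rw [h3]
  gcongr

/-- Pinsker's inequality on a finite set. -/
theorem sq_sum_abs_sub_le_two_mul_sum_mul_log {X : Type*} [Fintype X] {p q : X → ℝ}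
    (hp : ∀ x, 0 ≤ p x) (hq : ∀ x, 0 ≤ q x) (hp1 : ∑ x, p x = 1) (hq1 : ∑ x, q x = 1)
    (hpq : ∀ x, q x = 0 → p x = 0) :
    (∑ x, |p x - q x|) ^ 2 ≤ 2 * ∑ x, p x * Real.log (p x / q x) := by
  have hnn : ∀ x, 0 ≤ p x * Real.log (p x / q x) - p x + q x := by
    intro x
    rcases (hq x).eq_or_lt with h | h
    · simp [hpq x h.symm, ← h]
    · have h1 := sq_sub_le_mul_log (hp x) (hq x) (hpq x)
      have h2 : 0 < 2 / 3 * (p x + 2 * q x) := by have := hp x; positivity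
      exact nonneg_of_mul_nonneg_right ((sq_nonneg _).trans h1) h2
  have hcs := Finset.sum_sq_le_sum_mul_sum_of_sq_le_mul Finset.univ
    (r := fun x => |p x - q x|) (f := fun x => 2 / 3 * (p x + 2 * q x))
    (g := fun x => p x * Real.log (p x / q x) - p x + q x)
    (fun x _ => by have := hp x; have := hq x; positivity) (fun x _ => hnn x)
    (fun x _ => by
      rw [sq_abs]
      exact sq_sub_le_mul_log (hp x) (hq x) (hpq x))
  refine hcs.trans (le_of_eq ?_)
  rw [← Finset.mul_sum, Finset.sum_add_distrib, ← Finset.mul_sum, Finset.sum_add_distrib,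
    Finset.sum_sub_distrib, hp1, hq1]
  ring

/-- The `ℓ¹`-distance of the conditional law of the first variable, given that the second one
equals `y`, from its marginal law. -/
noncomputable def condDist {X Y : Type*} [Fintype X] [Fintype Y] (q : X → Y → ℝ) (y : Y) : ℝ :=
  ∑ x, |q x y / (∑ x', q x' y) - ∑ y', q x y'|

theorem half_sum_sq_condDist_le_mutualInfo {X Y : Type*} [Fintype X] [Fintype Y]
    {q : X → Y → ℝ} (hq : ∀ x y, 0 ≤ q x y) (hq1 : ∑ x, ∑ y, q x y = 1) :
    1 / 2 * ∑ y, (∑ x, q x y) * condDist q y ^ 2 ≤ mutualInfo q := by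
  unfold mutualInfo
  rw [Finset.sum_comm, Finset.mul_sum]
  refine Finset.sum_le_sum fun y _ => ?_
  have hnn : 0 ≤ ∑ x, q x y := Finset.sum_nonneg fun x _ => hq x y
  rcases hnn.eq_or_lt with h | h
  · have h0 : ∀ x, q x y = 0 := fun x =>
      (Finset.sum_eq_zero_iff_of_nonneg fun x _ => hq x y).1 h.symm x (Finset.mem_univ x)
    simp [h0]
  · have hp := sq_sum_abs_sub_le_two_mul_sum_mul_log
      (p := fun x => q x y / ∑ x', q x' y) (q := fun x => ∑ y', q x y')
      (fun x => div_nonneg (hq x y) hnn) (fun x => Finset.sum_nonneg fun y _ => hq x y)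
      (by rw [← Finset.sum_div, div_self h.ne']) hq1
      (fun x hx => by
        rw [(Finset.sum_eq_zero_iff_of_nonneg fun y _ => hq x y).1 hx y (Finset.mem_univ y),
          zero_div])
    have he : ∑ x, q x y * Real.log (q x y / ((∑ y', q x y') * ∑ x', q x' y)) =
        (∑ x, q x y) * ∑ x, q x y / (∑ x', q x' y) *
          Real.log (q x y / (∑ x', q x' y) / ∑ y', q x y') := by
      rw [Finset.mul_sum]
      refine Finset.sum_congr rfl fun x _ => ?_
      rw [div_div, mul_comm (∑ x', q x' y) (∑ y', q x y')]
      field_simp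
    rw [he]
    have := mul_le_mul_of_nonneg_left hp hnn
    unfold condDist
    linarith

/-- If the conditional laws over two disjoint sets of values are uniformly separated, then the
mutual information is bounded below. -/
theorem half_mul_sq_le_mutualInfo {X Y : Type*} [Fintype X] [Fintype Y] [DecidableEq Y]
    {q : X → Y → ℝ} (hq : ∀ x y, 0 ≤ q x y) (hq1 : ∑ x, ∑ y, q x y = 1) {F G : Finset Y}
    (hFG : Disjoint F G) {g : ℝ} (hg : 0 ≤ g)
    (hsep : ∀ y ∈ F, ∀ z ∈ G, 0 < ∑ x, q x y → 0 < ∑ x, q x z →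
      g ≤ condDist q y + condDist q z) :
    1 / 2 * ((∑ y ∈ F, ∑ x, q x y) * (∑ z ∈ G, ∑ x, q x z)) * g ^ 2 ≤ mutualInfo q := by
  set w : Y → ℝ := fun y => ∑ x, q x y with hw
  have hwn : ∀ y, 0 ≤ w y := fun y => Finset.sum_nonneg fun x _ => hq x y
  have hw1 : ∑ y, w y = 1 := by rw [← hq1, Finset.sum_comm]
  set U := ∑ y ∈ F, w y
  set V := ∑ z ∈ G, w z
  have hU : 0 ≤ U := Finset.sum_nonneg fun y _ => hwn y
  have hV : 0 ≤ V := Finset.sum_nonneg fun y _ => hwn y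
  have hUV : U + V ≤ 1 := by
    rw [← hw1, ← Finset.sum_union hFG]
    exact Finset.sum_le_sum_of_subset_of_nonneg (Finset.subset_univ _) fun y _ _ => hwn y
  refine le_trans ?_ (half_sum_sq_condDist_le_mutualInfo hq hq1)
  rw [mul_assoc]
  refine mul_le_mul_of_nonneg_left ?_ (by norm_num)
  have hsub : ∑ y ∈ F, w y * condDist q y ^ 2 + ∑ z ∈ G, w z * condDist q z ^ 2 ≤
      ∑ y, w y * condDist q y ^ 2 := by
    rw [← Finset.sum_union hFG]
    exact Finset.sum_le_sum_of_subset_of_nonneg (Finset.subset_univ _)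
      fun y _ _ => mul_nonneg (hwn y) (sq_nonneg _)
  refine le_trans ?_ hsub
  rcases (mul_nonneg hU hV).eq_or_lt with h0 | hpos
  · rw [← h0, zero_mul]
    exact add_nonneg (Finset.sum_nonneg fun y _ => mul_nonneg (hwn y) (sq_nonneg _))
      (Finset.sum_nonneg fun y _ => mul_nonneg (hwn y) (sq_nonneg _))
  refine le_of_mul_le_mul_left ?_ hpos
  have hpt : ∀ y ∈ F, ∀ z ∈ G, w y * w z * (U * V * g ^ 2) ≤
      w y * w z * (U * condDist q y ^ 2 + V * condDist q z ^ 2) := by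
    intro y hy z hz
    rcases (hwn y).eq_or_lt with h | hy0
    · simp [← h]
    rcases (hwn z).eq_or_lt with h | hz0
    · simp [← h]
    refine mul_le_mul_of_nonneg_left ?_ (mul_nonneg hy0.le hz0.le)
    have h1 : g ^ 2 ≤ (condDist q y + condDist q z) ^ 2 :=
      pow_le_pow_left₀ hg (hsep y hy z hz hy0 hz0) 2
    have h2 := mul_le_mul_of_nonneg_left h1 hpos.le
    have h3 : 0 ≤ U * condDist q y ^ 2 + V * condDist q z ^ 2 := by positivity
    nlinarith [sq_nonneg (U * condDist q y - V * condDist q z),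
      mul_le_mul_of_nonneg_right hUV h3]
  calc U * V * (U * V * g ^ 2)
      = ∑ y ∈ F, ∑ z ∈ G, w y * w z * (U * V * g ^ 2) := by
        simp_rw [← Finset.sum_mul]
        rw [Finset.sum_mul_sum]
    _ ≤ ∑ y ∈ F, ∑ z ∈ G, w y * w z * (U * condDist q y ^ 2 + V * condDist q z ^ 2) :=
        Finset.sum_le_sum fun y hy => Finset.sum_le_sum fun z hz => hpt y hy z hz
    _ = ∑ y ∈ F, ∑ z ∈ G, (U * (w y * condDist q y ^ 2) * w z +
          V * w y * (w z * condDist q z ^ 2)) :=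
        Finset.sum_congr rfl fun y _ => Finset.sum_congr rfl fun z _ => by ring
    _ = _ := by
        simp_rw [Finset.sum_add_distrib, ← Finset.mul_sum, ← Finset.sum_mul, ← Finset.mul_sum]
        ring

/-- A test function of oscillation at most `2 B` separates conditional laws. -/
theorem sub_le_mul_condDist_add {X Y : Type*} [Fintype X] [Fintype Y] {q : X → Y → ℝ} {y z : Y}
    (hy : 0 < ∑ x, q x y) (hz : 0 < ∑ x, q x z) {f : X → ℝ} {m B : ℝ}
    (hf : ∀ x, |f x - m| ≤ B) :
    (∑ x, f x * q x y) / (∑ x, q x y) - (∑ x, f x * q x z) / (∑ x, q x z) ≤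
      B * (condDist q y + condDist q z) := by
  have hform : ∀ y, 0 < ∑ x, q x y → ∑ x, (f x - m) * (q x y / (∑ x', q x' y) - ∑ y', q x y') =
      (∑ x, f x * q x y) / (∑ x, q x y) - m - ∑ x, (f x - m) * ∑ y', q x y' := by
    intro y hy
    simp_rw [mul_sub, Finset.sum_sub_distrib, sub_mul, Finset.sum_sub_distrib]
    rw [Finset.sum_div, ← Finset.mul_sum, ← Finset.sum_div, div_self hy.ne', mul_one]
    simp_rw [mul_div_assoc]
  have hbd : ∀ y, |∑ x, (f x - m) * (q x y / (∑ x', q x' y) - ∑ y', q x y')| ≤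
      B * condDist q y := by
    intro y
    refine (Finset.abs_sum_le_sum_abs _ _).trans ?_
    unfold condDist
    rw [Finset.mul_sum]
    refine Finset.sum_le_sum fun x _ => ?_
    rw [abs_mul]
    exact mul_le_mul_of_nonneg_right (hf x) (abs_nonneg _)
  have h1 := (abs_le.1 (hbd y)).2
  have h2 := (abs_le.1 (hbd z)).1
  rw [hform y hy] at h1
  rw [hform z hz] at h2
  linarith

/-- The log-sum inequality. -/
theorem sum_mul_log_div_le {X : Type*} (s : Finset X) {a b : X → ℝ} (ha : ∀ x ∈ s, 0 ≤ a x)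
    (hb : ∀ x ∈ s, 0 ≤ b x) (hab : ∀ x ∈ s, b x = 0 → a x = 0) :
    (∑ x ∈ s, a x) * Real.log ((∑ x ∈ s, a x) / ∑ x ∈ s, b x) ≤
      ∑ x ∈ s, a x * Real.log (a x / b x) := by
  have hA : 0 ≤ ∑ x ∈ s, a x := Finset.sum_nonneg ha
  have hB : 0 ≤ ∑ x ∈ s, b x := Finset.sum_nonneg hb
  rcases hA.eq_or_lt with h | hA
  · rw [← h, zero_mul]
    have := (Finset.sum_eq_zero_iff_of_nonneg ha).1 h.symm
    exact (Finset.sum_eq_zero fun x hx => by rw [this x hx, zero_mul]).ge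
  rcases hB.eq_or_lt with h | hB
  · have := (Finset.sum_eq_zero_iff_of_nonneg hb).1 h.symm
    exact absurd (Finset.sum_eq_zero fun x hx => hab x hx (this x hx)) hA.ne'
  set P := ∑ x ∈ s, a x
  set Q := ∑ x ∈ s, b x
  have hpt : ∀ x ∈ s, a x * Real.log (P / Q) + (a x - b x * (P / Q)) ≤
      a x * Real.log (a x / b x) := by
    intro x hx
    rcases (hb x hx).eq_or_lt with h | hbx
    · simp [hab x hx h.symm, ← h]
    rcases (ha x hx).eq_or_lt with h | hax
    · rw [← h]
      simp
      positivity
    have h1 : Real.log (P / Q) - Real.log (a x / b x) ≤ b x * (P / Q) / a x - 1 := by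
      rw [← Real.log_div (by positivity) (by positivity)]
      refine (Real.log_le_sub_one_of_pos (by positivity)).trans (le_of_eq ?_)
      field_simp
    have h2 := mul_le_mul_of_nonneg_left h1 hax.le
    have h3 : a x * (b x * (P / Q) / a x - 1) = b x * (P / Q) - a x := by
      field_simp
    rw [h3] at h2
    linarith
  have hs := Finset.sum_le_sum hpt
  rw [Finset.sum_add_distrib, ← Finset.sum_mul, Finset.sum_sub_distrib, ← Finset.sum_mul] at hs
  have : Q * (P / Q) = P := by field_simp
  linarith

/-- Data processing: coarsening the second variable does not increase the mutual information. -/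
theorem mutualInfo_map_le {X Y Z : Type*} [Fintype X] [Fintype Y] [Fintype Z] [DecidableEq Z]
    {q : X → Y → ℝ} (hq : ∀ x y, 0 ≤ q x y) (φ : Y → Z) :
    mutualInfo (fun x z => ∑ y with φ y = z, q x y) ≤ mutualInfo q := by
  unfold mutualInfo
  refine Finset.sum_le_sum fun x _ => ?_
  rw [← Finset.sum_fiberwise (s := Finset.univ) (g := φ)
    (f := fun y => q x y * Real.log (q x y / ((∑ y', q x y') * ∑ x', q x' y)))]
  refine Finset.sum_le_sum fun z _ => ?_
  rw [Finset.sum_fiberwise (s := Finset.univ) (g := φ) (f := fun y => q x y),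
    Finset.sum_comm (s := Finset.univ) (t := Finset.univ.filter fun y => φ y = z),
    Finset.mul_sum]
  refine sum_mul_log_div_le _ (fun y _ => hq x y) (fun y _ => mul_nonneg
    (Finset.sum_nonneg fun y _ => hq x y) (Finset.sum_nonneg fun x _ => hq x y)) ?_
  intro y _ h
  rcases mul_eq_zero.1 h with h | h
  · exact (Finset.sum_eq_zero_iff_of_nonneg fun y _ => hq x y).1 h y (Finset.mem_univ y)
  · exact (Finset.sum_eq_zero_iff_of_nonneg fun x _ => hq x y).1 h x (Finset.mem_univ x)

/-- The entropy of an unnormalized probability vector, multiplied by its total mass. -/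
noncomputable def massEntropy {Y : Type*} [Fintype Y] (v : Y → ℝ) : ℝ :=
  ∑ y, v y * Real.log ((∑ y', v y') / v y)

theorem massEntropy_nonneg {Y : Type*} [Fintype Y] {v : Y → ℝ} (hv : ∀ y, 0 ≤ v y) :
    0 ≤ massEntropy v := by
  refine Finset.sum_nonneg fun y _ => ?_
  rcases (hv y).eq_or_lt with h | h
  · simp [← h]
  · refine mul_nonneg h.le (Real.log_nonneg ?_)
    rw [one_le_div h]
    exact Finset.single_le_sum (fun y _ => hv y) (Finset.mem_univ y)

theorem massEntropy_eq_entropy {Y : Type*} [Fintype Y] {v : Y → ℝ} (hv : ∑ y, v y = 1) :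
    massEntropy v = entropy v := by
  unfold massEntropy entropy
  refine Finset.sum_congr rfl fun y _ => ?_
  rw [hv, one_div, Real.log_inv, Real.negMulLog]
  ring

/-- The entropy is at most the logarithm of the number of values. -/
theorem entropy_le_log_card {Y : Type*} [Fintype Y] {v : Y → ℝ} (hv : ∀ y, 0 ≤ v y)
    (hv1 : ∑ y, v y = 1) : entropy v ≤ Real.log (Fintype.card Y) := by
  have h := sum_mul_log_div_le Finset.univ (a := v) (b := fun _ => 1) (fun y _ => hv y)
    (fun _ _ => zero_le_one) (fun _ _ h => absurd h one_ne_zero)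
  rw [hv1, one_mul, Finset.sum_const, Finset.card_univ, nsmul_eq_mul, mul_one, one_div,
    Real.log_inv] at h
  simp only [div_one] at h
  unfold entropy
  simp only [Real.negMulLog, neg_mul, Finset.sum_neg_distrib]
  linarith

/-- Chain rule: the mass-weighted mutual information is the decrease of the entropy of the second
variable when the first one is revealed. -/
theorem mul_mutualInfo_eq_massEntropy_sub {X Y : Type*} [Fintype X] [Fintype Y]
    {q : X → Y → ℝ} {v : X → Y → ℝ} {w : ℝ} (hw : 0 < w) (hq : ∀ x y, 0 ≤ q x y)
    (hq1 : ∑ x, ∑ y, q x y = 1) (hv : ∀ x y, v x y = w * q x y) :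
    w * mutualInfo q = massEntropy (fun y => ∑ x, v x y) - ∑ x, massEntropy (v x) := by
  have htot : ∑ y, ∑ x, v x y = w := by
    rw [Finset.sum_comm]
    simp_rw [hv, ← Finset.mul_sum, hq1, mul_one]
  unfold massEntropy mutualInfo
  rw [htot]
  simp_rw [Finset.sum_mul]
  rw [Finset.sum_comm (s := (Finset.univ : Finset Y)), ← Finset.sum_sub_distrib, Finset.mul_sum]
  refine Finset.sum_congr rfl fun x _ => ?_
  rw [← Finset.sum_sub_distrib, Finset.mul_sum]
  refine Finset.sum_congr rfl fun y _ => ?_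
  simp_rw [hv, ← Finset.mul_sum]
  rcases (hq x y).eq_or_lt with h | h
  · simp [← h]
  have hx : 0 < ∑ y', q x y' :=
    h.trans_le (Finset.single_le_sum (fun y _ => hq x y) (Finset.mem_univ y))
  have hy : 0 < ∑ x', q x' y :=
    h.trans_le (Finset.single_le_sum (f := fun x => q x y) (fun x _ => hq x y)
      (Finset.mem_univ x))
  rw [mul_div_mul_left _ _ hw.ne', div_mul_cancel_left₀ hw.ne', Real.log_inv,
    ← Finset.sum_mul, Real.log_div h.ne' (by positivity), Real.log_div hx.ne' h.ne',
    Real.log_mul hx.ne' hy.ne']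
  ring

namespace MDP

variable {S A : Type*} [Fintype S]

/-! ### Values and regret -/

theorem nonempty_state (M : MDP S A) : Nonempty S := by
  by_contra h
  rw [not_nonempty_iff] at h
  simpa using M.init_sum

section Values

variable [DecidableEq S] (M : MDP S A)

theorem policyMatrix_pow_nonneg (π : S → A) (t : ℕ) (s s' : S) :
    0 ≤ (M.policyMatrix π ^ t) s s' := by
  induction t generalizing s s' with
  | zero => by_cases h : s = s' <;> simp [h]
  | succ t ih =>
    rw [pow_succ', Matrix.mul_apply]
    exact Finset.sum_nonneg fun u _ => mul_nonneg (M.trans_nonneg _ _ _) (ih _ _)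

theorem policyMatrix_pow_sum (π : S → A) (t : ℕ) (s : S) :
    ∑ s', (M.policyMatrix π ^ t) s s' = 1 := by
  induction t generalizing s with
  | zero => simp [Matrix.one_apply]
  | succ t ih =>
    simp_rw [pow_succ', Matrix.mul_apply]
    rw [Finset.sum_comm]
    simp_rw [← Finset.mul_sum, ih, mul_one]
    exact M.trans_sum s (π s)

theorem summable_disc_mul_policyMatrix_pow (π : S → A) (s s' : S) :
    Summable fun t : ℕ => M.disc ^ t * (M.policyMatrix π ^ t) s s' := by
  refine Summable.of_nonneg_of_le
    (fun t => mul_nonneg (pow_nonneg M.disc_pos.le t) (M.policyMatrix_pow_nonneg π t s s'))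
    (fun t => ?_) (summable_geometric_of_lt_one M.disc_pos.le M.disc_lt_one)
  refine mul_le_of_le_one_right (pow_nonneg M.disc_pos.le t) ?_
  rw [← M.policyMatrix_pow_sum π t s]
  exact Finset.single_le_sum (fun u _ => M.policyMatrix_pow_nonneg π t s u) (Finset.mem_univ s')

theorem summable_value (r : Reward S A) (π : S → A) (s : S) :
    Summable fun t : ℕ => M.disc ^ t * ∑ s', (M.policyMatrix π ^ t) s s' * r (s', π s') := by
  simp_rw [Finset.mul_sum, ← mul_assoc]
  exact summable_sum fun s' _ => (M.summable_disc_mul_policyMatrix_pow π s s').mul_right _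

/-- The value is a linear function of the reward. -/
theorem value_eq_sum (r : Reward S A) (π : S → A) (s : S) :
    M.value r π s =
      ∑ s', (∑' t : ℕ, M.disc ^ t * (M.policyMatrix π ^ t) s s') * r (s', π s') := by
  unfold value
  simp_rw [Finset.mul_sum, ← mul_assoc]
  rw [Summable.tsum_finsetSum fun s' _ =>
    (M.summable_disc_mul_policyMatrix_pow π s s').mul_right _]
  simp_rw [tsum_mul_right]

/-- The Bellman equation of a policy. -/
theorem value_eq (r : Reward S A) (π : S → A) (s : S) :
    M.value r π s = r (s, π s) + M.disc * ∑ s', M.trans s (π s) s' * M.value r π s' := by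
  have hs := M.summable_value r π
  have hterm : ∀ t : ℕ, M.disc ^ (t + 1) *
      ∑ s', (M.policyMatrix π ^ (t + 1)) s s' * r (s', π s') =
        M.disc * ∑ u, M.trans s (π s) u *
          (M.disc ^ t * ∑ s', (M.policyMatrix π ^ t) u s' * r (s', π s')) := by
    intro t
    have h1 : ∑ s', (M.policyMatrix π ^ (t + 1)) s s' * r (s', π s') =
        ∑ u, M.trans s (π s) u * ∑ s', (M.policyMatrix π ^ t) u s' * r (s', π s') := by
      simp_rw [pow_succ', Matrix.mul_apply, Finset.sum_mul, Finset.mul_sum]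
      rw [Finset.sum_comm]
      refine Finset.sum_congr rfl fun u _ => Finset.sum_congr rfl fun s' _ => ?_
      rw [mul_assoc]
      rfl
    rw [h1, pow_succ', mul_assoc, Finset.mul_sum]
    simp_rw [mul_left_comm]
  have h := (hs s).tsum_eq_zero_add
  simp_rw [hterm] at h
  rw [tsum_mul_left, Summable.tsum_finsetSum fun u _ => (hs u).mul_left (M.trans s (π s) u)] at h
  simp_rw [tsum_mul_left] at h
  rw [value, h]
  simp [Matrix.one_apply, value]

theorem measurable_value (π : S → A) (s : S) : Measurable fun r => M.value r π s := by
  simp_rw [M.value_eq_sum]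
  fun_prop

theorem immRegret_eq_zero_iff (r : Reward S A) (s : S) (b a : A) :
    M.immRegret r s b a = 0 ↔ M.optQ r s a ≤ M.optQ r s b := by
  unfold immRegret
  rw [max_eq_left_iff, sub_nonpos]

theorem policyLevels_eq_correct_iff {ε : ℝ} {π : S → A} {r : Reward S A} {s : S} {a : A} :
    M.policyLevels ε π r (s, a) = Level.correct ↔ M.optQ r s a ≤ M.optQ r s (π s) := by
  unfold policyLevels regretLevels
  rw [← M.immRegret_eq_zero_iff]
  split_ifs <;> simp_all

theorem policyLevels_eq_notCorrect_iff {ε : ℝ} (hε : 0 < ε) {π : S → A} {r : Reward S A} {s : S}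
    {a : A} : M.policyLevels ε π r (s, a) = Level.notCorrect ↔
      ε * (1 - M.disc) ≤ M.optQ r s a - M.optQ r s (π s) := by
  have hc : 0 < ε * (1 - M.disc) := mul_pos hε (sub_pos.2 M.disc_lt_one)
  unfold policyLevels regretLevels
  dsimp only
  by_cases h : M.immRegret r s (π s) a = 0
  · have := (M.immRegret_eq_zero_iff r s (π s) a).1 h
    simp only [h, if_true, reduceCtorEq, false_iff, not_le]
    linarith
  · have h1 : M.immRegret r s (π s) a = M.optQ r s a - M.optQ r s (π s) := by
      rw [M.immRegret_eq_zero_iff, not_le] at h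
      exact max_eq_right (sub_nonneg.2 h.le)
    rw [if_neg h, h1]
    split_ifs with h2 <;> simp_all

variable [Fintype A]

theorem value_le_optValue (r : Reward S A) (π : S → A) (s : S) :
    M.value r π s ≤ M.optValue r s := by
  classical
  exact le_ciSup (f := fun π => M.value r π s) (Set.finite_range _).bddAbove π

theorem exists_optValue_le_optQ [Nonempty A] (r : Reward S A) (s : S) :
    ∃ a, M.optValue r s ≤ M.optQ r s a := by
  classical
  obtain ⟨π, hπ⟩ := exists_eq_ciSup_of_finite (f := fun π => M.value r π s)
  refine ⟨π s, ?_⟩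
  have h : M.optValue r s = M.value r π s := hπ.symm
  rw [h, M.value_eq]
  unfold optQ
  have := M.disc_pos
  gcongr with s' _
  · exact M.trans_nonneg _ _ _
  · exact M.value_le_optValue r π s'

/-- A policy of large regret takes an action of large immediate regret in some state. -/
theorem exists_immediate_regret_of_le_regret [Nonempty A] {ε : ℝ} {r : Reward S A} {π : S → A}
    (h : ε ≤ M.regret r π) :
    ∃ s a, ε * (1 - M.disc) ≤ M.optQ r s a - M.optQ r s (π s) := by
  by_contra! hc
  have := M.nonempty_state
  have hγ : 0 < 1 - M.disc := sub_pos.2 M.disc_lt_one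
  obtain ⟨s, hs⟩ := Finite.exists_max fun s => M.optValue r s - M.value r π s
  have hmax : M.optValue r s - M.value r π s < ε := by
    obtain ⟨a, ha⟩ := M.exists_optValue_le_optQ r s
    have h1 := hc s a
    have h2 : M.optQ r s (π s) - M.value r π s ≤
        M.disc * (M.optValue r s - M.value r π s) := by
      rw [M.value_eq r π s]
      unfold optQ
      rw [add_sub_add_left_eq_sub, ← mul_sub, ← Finset.sum_sub_distrib]
      refine mul_le_mul_of_nonneg_left ?_ M.disc_pos.le
      calc _ ≤ ∑ s', M.trans s (π s) s' * (M.optValue r s - M.value r π s) :=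
            Finset.sum_le_sum fun s' _ => by
              rw [← mul_sub]
              exact mul_le_mul_of_nonneg_left (hs s') (M.trans_nonneg _ _ _)
        _ = _ := by rw [← Finset.sum_mul, M.trans_sum, one_mul]; exact M.value_eq r π s ▸ rfl
    have h3 : (M.optValue r s - M.value r π s) * (1 - M.disc) < ε * (1 - M.disc) := by
      linarith
    exact lt_of_mul_lt_mul_right h3 hγ.le
  have : M.regret r π ≤ M.optValue r s - M.value r π s := by
    unfold regret
    calc _ ≤ ∑ s', M.init s' * (M.optValue r s - M.value r π s) :=
          Finset.sum_le_sum fun s' _ => mul_le_mul_of_nonneg_left (hs s') (M.init_nonneg _)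
      _ = _ := by rw [← Finset.sum_mul, M.init_sum, one_mul]
  linarith

theorem measurable_optValue (s : S) : Measurable fun r => M.optValue r s := by
  classical
  unfold optValue
  exact Measurable.iSup fun π => M.measurable_value π s

theorem measurable_optQ (s : S) (a : A) : Measurable fun r => M.optQ r s a := by
  unfold optQ
  have := M.measurable_optValue
  fun_prop

theorem exists_isOptAction [Nonempty A] (r : Reward S A) (s : S) : ∃ a, M.IsOptAction r s a :=
  Finite.exists_max fun a => M.optQ r s a

theorem measurableSet_regretLevels_eq (ε : ℝ) (e : S × A × A → Level) :
    MeasurableSet {r | M.regretLevels ε r = e} := by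
  have hm : ∀ s b a, Measurable fun r => M.immRegret r s b a := fun s b a =>
    measurable_const.max ((M.measurable_optQ s a).sub (M.measurable_optQ s b))
  have : {r | M.regretLevels ε r = e} = ⋂ x, {r | M.regretLevels ε r x = e x} := by
    ext r; simp [funext_iff]
  rw [this]
  refine MeasurableSet.iInter fun x => ?_
  have h0 : MeasurableSet {r | M.immRegret r x.1 x.2.1 x.2.2 = 0} :=
    measurableSet_eq_fun (hm _ _ _) measurable_const
  have h1 : MeasurableSet {r | M.immRegret r x.1 x.2.1 x.2.2 < ε * (1 - M.disc)} :=
    measurableSet_lt (hm _ _ _) measurable_const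
  unfold regretLevels
  cases e x
  · convert h0 using 1; ext r
    simp only [Set.mem_ofPred_eq]
    split_ifs <;> simp_all
  · convert h0.compl.inter h1 using 1; ext r
    simp only [Set.mem_ofPred_eq, Set.mem_inter_iff, Set.mem_compl_iff]
    split_ifs <;> simp_all
  · convert h0.compl.inter h1.compl using 1; ext r
    simp only [Set.mem_ofPred_eq, Set.mem_inter_iff, Set.mem_compl_iff]
    split_ifs <;> simp_all

/-- The levels of a policy, as a function of the aggregate levels. -/
def restrictLevels (π : S → A) (e : S × A × A → Level) : S × A → Level :=
  fun x => e (x.1, π x.1, x.2)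

theorem policyLevels_preimage_eq_iUnion [DecidableEq A] (ε : ℝ) (π : S → A)
    (e : S × A → Level) :
    {r | M.policyLevels ε π r = e} =
      ⋃ e' ∈ Finset.univ.filter (fun e' : S × A × A → Level => restrictLevels π e' = e),
        {r | M.regretLevels ε r = e'} := by
  ext r
  simp only [Set.mem_ofPred_eq, Finset.mem_filter, Finset.mem_univ, true_and, Set.mem_iUnion,
    exists_prop, exists_eq_right']
  rfl

theorem measurableSet_policyLevels_eq (ε : ℝ) (π : S → A) (e : S × A → Level) :
    MeasurableSet {r | M.policyLevels ε π r = e} := by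
  classical
  rw [M.policyLevels_preimage_eq_iUnion]
  exact Finset.measurableSet_biUnion _ fun e' _ => M.measurableSet_regretLevels_eq ε e'

/-! ### The expert and its demonstrations -/

theorem expert_nonneg (β : ℝ) (r : Reward S A) (s : S) (a : A) : 0 ≤ M.expert β r s a := by
  unfold expert; positivity

theorem expert_sum [Nonempty A] (β : ℝ) (r : Reward S A) (s : S) :
    ∑ a, M.expert β r s a = 1 := by
  unfold expert
  rw [← Finset.sum_div, div_self]
  exact (Finset.sum_pos (fun a _ => Real.exp_pos _) Finset.univ_nonempty).ne'

theorem measurable_expert (β : ℝ) (s : S) (a : A) : Measurable fun r => M.expert β r s a := by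
  have := M.measurable_optQ s
  unfold expert
  fun_prop

theorem expert_le_of_add_le {β : ℝ} (hβ : 0 < β) {c : ℝ} {r : Reward S A} {s : S} {a b : A}
    (h : c ≤ M.optQ r s a - M.optQ r s b) :
    M.expert β r s b ≤ Real.exp (-(β * c)) * M.expert β r s a := by
  unfold expert
  rw [← mul_div_assoc, ← Real.exp_add]
  gcongr
  have := mul_le_mul_of_nonneg_left h hβ.le
  linarith

theorem inv_card_le_expert [Nonempty A] {β : ℝ} (hβ : 0 < β) {r : Reward S A} {s : S} {a : A}
    (h : M.IsOptAction r s a) : 1 / (Fintype.card A : ℝ) ≤ M.expert β r s a := by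
  have hn : 0 < (Fintype.card A : ℝ) := by exact_mod_cast Fintype.card_pos
  rw [div_le_iff₀ hn, ← M.expert_sum β r s, mul_comm, ← nsmul_eq_mul, ← Finset.card_univ]
  refine Finset.sum_le_card_nsmul _ _ _ fun a' _ => ?_
  have := M.expert_le_of_add_le hβ (c := 0) (sub_nonneg.2 (h a'))
  simpa using this

theorem likelihood_cons (β : ℝ) {T : ℕ} (r : Reward S A) (x : S × A) (d : Demo S A T) :
    M.likelihood β r (Fin.cons x d : Demo S A (T + 1)) =
      M.expert β r x.1 x.2 * (M.trans x.1 x.2 (d 0).1 * M.likelihood β r d) := by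
  have h1 : ∏ t, M.expert β r ((Fin.cons x d : Demo S A (T + 1)) t).1
      ((Fin.cons x d : Demo S A (T + 1)) t).2 =
        M.expert β r x.1 x.2 * ∏ t, M.expert β r (d t).1 (d t).2 := by
    rw [Fin.prod_univ_succ]
    simp
  have h2 : ∏ t : Fin (T + 1), M.trans ((Fin.cons x d : Demo S A (T + 1)) t.castSucc).1
      ((Fin.cons x d : Demo S A (T + 1)) t.castSucc).2
        ((Fin.cons x d : Demo S A (T + 1)) t.succ).1 = M.trans x.1 x.2 (d 0).1 *
          ∏ t : Fin T, M.trans (d t.castSucc).1 (d t.castSucc).2 (d t.succ).1 := by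
    rw [Fin.prod_univ_succ]
    simp [Fin.castSucc_succ]
  unfold likelihood
  rw [h1, h2]
  ring

theorem sum_mul_likelihood [Nonempty A] (β : ℝ) (T : ℕ) (r : Reward S A)
    (ψ : S × A → ℝ) :
    ∑ d : Demo S A T, ψ (d 0) * M.likelihood β r d = ∑ x, ψ x * M.expert β r x.1 x.2 := by
  induction T generalizing ψ with
  | zero =>
    rw [← (Equiv.funUnique (Fin 1) (S × A)).symm.sum_comp]
    simp [likelihood]
  | succ T ih =>
    rw [← (Fin.consEquiv fun _ : Fin (T + 2) => S × A).sum_comp, Fintype.sum_prod_type]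
    refine Finset.sum_congr rfl fun x _ => ?_
    simp only [Fin.consEquiv, Equiv.coe_fn_mk, M.likelihood_cons, Fin.cons_zero]
    simp_rw [← mul_assoc (ψ x), ← Finset.mul_sum]
    rw [ih fun y => M.trans x.1 x.2 y.1, Fintype.sum_prod_type]
    simp_rw [← Finset.mul_sum, M.expert_sum, mul_one, M.trans_sum, mul_one]

/-- The first action of a demonstration is drawn from the expert policy in the queried state. -/
theorem sum_mul_demoProb [Nonempty A] (β : ℝ) (T : ℕ) (r : Reward S A) (s : S)
    (φ : A → ℝ) :
    ∑ d : Demo S A T, φ (d 0).2 * M.demoProb β r s d = ∑ a, φ a * M.expert β r s a := by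
  have h := M.sum_mul_likelihood β T r fun x => if x.1 = s then φ x.2 else 0
  rw [Fintype.sum_prod_type] at h
  simp only [ite_mul, zero_mul] at h
  rw [Finset.sum_comm] at h
  simp only [Finset.sum_ite_eq', Finset.mem_univ, if_true] at h
  rw [← h]
  refine Finset.sum_congr rfl fun d _ => ?_
  unfold demoProb
  split_ifs <;> simp

theorem sum_demoProb [Nonempty A] (β : ℝ) (T : ℕ) (r : Reward S A) (s : S) :
    ∑ d : Demo S A T, M.demoProb β r s d = 1 := by
  have := M.sum_mul_demoProb β T r s fun _ => 1
  simpa [M.expert_sum] using this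

theorem likelihood_nonneg (β : ℝ) {T : ℕ} (r : Reward S A) (d : Demo S A T) :
    0 ≤ M.likelihood β r d :=
  mul_nonneg (Finset.prod_nonneg fun _ _ => M.expert_nonneg _ _ _ _)
    (Finset.prod_nonneg fun _ _ => M.trans_nonneg _ _ _)

theorem measurable_likelihood (β : ℝ) {T : ℕ} (d : Demo S A T) :
    Measurable fun r => M.likelihood β r d := by
  unfold likelihood
  exact (Finset.measurable_fun_prod _ fun t _ => M.measurable_expert β _ _).mul_const _

theorem demoProb_nonneg (β : ℝ) {T : ℕ} (r : Reward S A) (s : S) (d : Demo S A T) :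
    0 ≤ M.demoProb β r s d := by
  unfold demoProb
  split_ifs
  exacts [M.likelihood_nonneg β r d, le_rfl]

theorem demoProb_le_one [Nonempty A] (β : ℝ) {T : ℕ} (r : Reward S A) (s : S) (d : Demo S A T) :
    M.demoProb β r s d ≤ 1 := by
  classical
  rw [← M.sum_demoProb β T r s]
  exact Finset.single_le_sum (f := fun d => M.demoProb β r s d)
    (fun d _ => M.demoProb_nonneg β r s d) (Finset.mem_univ d)

theorem measurable_demoProb (β : ℝ) {T : ℕ} (s : S) (d : Demo S A T) :
    Measurable fun r => M.demoProb β r s d := by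
  unfold demoProb
  split_ifs
  exacts [M.measurable_likelihood β d, measurable_const]

theorem integrable_demoProb [Nonempty A] (β : ℝ) {T : ℕ} (s : S) (d : Demo S A T)
    (ν : Measure (Reward S A)) [IsFiniteMeasure ν] :
    Integrable (fun r => M.demoProb β r s d) ν := by
  refine Integrable.of_bound (M.measurable_demoProb β s d).aestronglyMeasurable 1
    (Filter.Eventually.of_forall fun r => ?_)
  rw [Real.norm_of_nonneg (M.demoProb_nonneg β r s d)]
  exact M.demoProb_le_one β r s d

end Values

end MDP

theorem sum_measureReal_fiber {Ω Y : Type*} [MeasurableSpace Ω] (ν : Measure Ω)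
    [IsFiniteMeasure ν] {f : Ω → Y} (hf : ∀ y, MeasurableSet {ω | f ω = y}) (F : Finset Y) :
    ∑ y ∈ F, ν.real {ω | f ω = y} = ν.real {ω | f ω ∈ F} := by
  exact sum_measureReal_preimage_singleton F fun y _ => hf y

namespace MDP

variable {S A : Type*} [Fintype S] [DecidableEq S] [Fintype A] (M : MDP S A)

/-- Where some action is not correct, the incorrect actions jointly are more likely to be
demonstrated than the one taken by the policy. -/
theorem div_card_le_sum_expert_sub [Nonempty A] {β ε : ℝ} (hβ : 0 < β) (hε : 0 < ε)
    {r : Reward S A} {π : S → A} {s : S} {K : Finset A} (hK : K.Nonempty)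
    (h : ∀ a, a ∈ K ↔ M.policyLevels ε π r (s, a) = Level.notCorrect) :
    (1 - Real.exp (-(β * (1 - M.disc) * ε))) / Fintype.card A ≤
      ∑ a ∈ K, (M.expert β r s a - M.expert β r s (π s)) := by
  simp_rw [M.policyLevels_eq_notCorrect_iff hε] at h
  obtain ⟨a₀, ha₀⟩ := hK
  obtain ⟨a, ha⟩ := M.exists_isOptAction r s
  have haK : a ∈ K := (h a).2 (((h a₀).1 ha₀).trans (sub_le_sub_right (ha a₀) _))
  have hexp : β * (1 - M.disc) * ε = β * (ε * (1 - M.disc)) := by ring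
  have hκ : Real.exp (-(β * (ε * (1 - M.disc)))) ≤ 1 := by
    have := M.disc_lt_one
    refine Real.exp_le_one_iff.2 (neg_nonpos.2 ?_)
    exact mul_nonneg hβ.le (mul_nonneg hε.le (by linarith))
  rw [hexp]
  have hpt : ∀ a ∈ K, (1 - Real.exp (-(β * (ε * (1 - M.disc))))) * M.expert β r s a ≤
      M.expert β r s a - M.expert β r s (π s) := by
    intro a ha
    have := M.expert_le_of_add_le hβ ((h a).1 ha)
    linarith
  have hn : ∀ a ∈ K, 0 ≤ M.expert β r s a - M.expert β r s (π s) := fun a ha =>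
    (mul_nonneg (sub_nonneg.2 hκ) (M.expert_nonneg β r s a)).trans (hpt a ha)
  refine le_trans ?_ (Finset.single_le_sum hn haK)
  refine le_trans ?_ (hpt a haK)
  rw [div_eq_mul_one_div]
  exact mul_le_mul_of_nonneg_left (M.inv_card_le_expert hβ ha) (sub_nonneg.2 hκ)

/-! ### The information gained by a query -/

section Joint

variable [Nonempty A] (β : ℝ) (ν : Measure (Reward S A)) [IsFiniteMeasure ν]

theorem sum_mul_setIntegral_demoProb (T : ℕ) (s : S) (φ : A → ℝ) (B : Set (Reward S A)) :
    ∑ d : Demo S A T, φ (d 0).2 * ∫ r in B, M.demoProb β r s d ∂ν =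
      ∫ r in B, ∑ a, φ a * M.expert β r s a ∂ν := by
  simp_rw [← integral_const_mul]
  rw [← integral_finsetSum _ fun d _ => (M.integrable_demoProb β s d _).const_mul _]
  simp_rw [M.sum_mul_demoProb β T]

theorem sum_setIntegral_demoProb (T : ℕ) (s : S) (B : Set (Reward S A)) :
    ∑ d : Demo S A T, ∫ r in B, M.demoProb β r s d ∂ν = ν.real B := by
  have h := M.sum_mul_setIntegral_demoProb β ν T s (fun _ => 1) B
  simpa [M.expert_sum] using h

variable [DecidableEq A]

theorem sum_setIntegral_demoProb_policyLevels (ε : ℝ) {T : ℕ} (s : S) (π : S → A)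
    (d : Demo S A T) (e : S × A → Level) :
    ∑ e' with restrictLevels π e' = e,
      ∫ r in {r | M.regretLevels ε r = e'}, M.demoProb β r s d ∂ν =
        ∫ r in {r | M.policyLevels ε π r = e}, M.demoProb β r s d ∂ν := by
  rw [M.policyLevels_preimage_eq_iUnion]
  refine (integral_biUnion_finset _ (fun e' _ => M.measurableSet_regretLevels_eq ε e') ?_
    fun e' _ => (M.integrable_demoProb β s d ν).integrableOn).symm
  intro y _ z _ hyz
  refine Set.disjoint_left.2 fun r h1 h2 => hyz ?_
  exact (show M.regretLevels ε r = y from h1).symm.trans h2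

/-- The aggregate levels are at least as informative as those of a policy. -/
theorem mutualInfo_policyLevels_le (ε : ℝ) (T : ℕ) (s : S) (π : S → A) :
    mutualInfo (fun (d : Demo S A T) e =>
      ∫ r in {r | M.policyLevels ε π r = e}, M.demoProb β r s d ∂ν) ≤
    mutualInfo (fun (d : Demo S A T) e =>
      ∫ r in {r | M.regretLevels ε r = e}, M.demoProb β r s d ∂ν) := by
  simp_rw [← M.sum_setIntegral_demoProb_policyLevels β ν ε s π]
  exact mutualInfo_map_le (fun d e => integral_nonneg fun r => M.demoProb_nonneg β r s d) _

end Joint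

variable [DecidableEq A]

theorem sum_mul_expert_indicator_sub (β : ℝ) (r : Reward S A) (s : S) (b : A) (K : Finset A) :
    ∑ a, ((if a ∈ K then (1 : ℝ) else 0) - if a = b then (K.card : ℝ) else 0) *
      M.expert β r s a = ∑ a ∈ K, (M.expert β r s a - M.expert β r s b) := by
  simp_rw [sub_mul, ite_mul, zero_mul, one_mul]
  rw [Finset.sum_sub_distrib, Finset.sum_sub_distrib, Finset.sum_ite_mem, Finset.univ_inter,
    Finset.sum_ite_eq' Finset.univ b, if_pos (Finset.mem_univ b), Finset.sum_const, nsmul_eq_mul]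

/-- Two values of the levels of a policy, one with an incorrect action in the queried state and one
where all actions are correct, induce well separated laws of the demonstration. -/
theorem le_condDist_add_condDist [Nonempty A] {β ε : ℝ} (hβ : 0 < β) (hε : 0 < ε)
    (ν : Measure (Reward S A)) [IsFiniteMeasure ν] (T : ℕ) (π : S → A) (s : S)
    {e e' : S × A → Level} (he : ∃ a, e (s, a) = Level.notCorrect)
    (he' : ∀ a, e' (s, a) = Level.correct)
    (hpe : 0 < ν.real {r | M.policyLevels ε π r = e})
    (hpe' : 0 < ν.real {r | M.policyLevels ε π r = e'}) :
    2 * (1 - Real.exp (-(β * (1 - M.disc) * ε))) / (Fintype.card A : ℝ) ^ 2 ≤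
      condDist (fun (d : Demo S A T) e =>
        ∫ r in {r | M.policyLevels ε π r = e}, M.demoProb β r s d ∂ν) e +
      condDist (fun (d : Demo S A T) e =>
        ∫ r in {r | M.policyLevels ε π r = e}, M.demoProb β r s d ∂ν) e' := by
  set κ := 1 - Real.exp (-(β * (1 - M.disc) * ε))
  set n : ℝ := (Fintype.card A : ℝ)
  have hn : 0 < n := by simp only [n]; exact_mod_cast Fintype.card_pos
  set q : Demo S A T → (S × A → Level) → ℝ := fun d e =>
    ∫ r in {r | M.policyLevels ε π r = e}, M.demoProb β r s d ∂ν
  have hqsum : ∀ e, ∑ d, q d e = ν.real {r | M.policyLevels ε π r = e} := fun e =>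
    M.sum_setIntegral_demoProb β ν T s _
  set K : Finset A := Finset.univ.filter fun a => e (s, a) = Level.notCorrect
  have hKne : K.Nonempty := by
    obtain ⟨a, ha⟩ := he
    exact ⟨a, by simp [K, ha]⟩
  set φ : A → ℝ := fun a => (if a ∈ K then (1 : ℝ) else 0) - if a = π s then (K.card : ℝ) else 0
  have hint : IntegrableOn (fun r => ∑ a ∈ K, (M.expert β r s a - M.expert β r s (π s)))
      Set.univ ν := by
    refine integrable_finsetSum _ fun a _ => ?_
    refine Integrable.of_bound ((M.measurable_expert β s a).sub
      (M.measurable_expert β s (π s))).aestronglyMeasurable 1 (.of_forall fun r => ?_)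
    have hle : ∀ a, M.expert β r s a ≤ 1 := fun a => by
      rw [← M.expert_sum β r s]
      exact Finset.single_le_sum (fun a _ => M.expert_nonneg β r s a) (Finset.mem_univ a)
    rw [Real.norm_eq_abs, abs_le]
    constructor <;> linarith [hle a, hle (π s), M.expert_nonneg β r s a,
      M.expert_nonneg β r s (π s)]
  have hφ : ∀ e, ∑ d, φ (d 0).2 * q d e = ∫ r in {r | M.policyLevels ε π r = e},
      ∑ a ∈ K, (M.expert β r s a - M.expert β r s (π s)) ∂ν := by
    intro e
    rw [M.sum_mul_setIntegral_demoProb β ν T s φ]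
    simp_rw [φ, M.sum_mul_expert_indicator_sub]
  have h1 : κ / n * ∑ d, q d e ≤ ∑ d, φ (d 0).2 * q d e := by
    rw [hφ, hqsum]
    refine setIntegral_ge_of_const_le_real (M.measurableSet_policyLevels_eq ε π e)
      (measure_ne_top _ _) (fun r hr => ?_) (hint.mono_set (Set.subset_univ _))
    refine M.div_card_le_sum_expert_sub hβ hε (π := π) hKne fun a => ?_
    rw [show M.policyLevels ε π r = e from hr]
    simp [K]
  have h2 : ∑ d, φ (d 0).2 * q d e' ≤ 0 := by
    rw [hφ]
    refine setIntegral_nonpos (M.measurableSet_policyLevels_eq ε π e') fun r hr => ?_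
    refine Finset.sum_nonpos fun a _ => sub_nonpos.2 ?_
    have hc := he' a
    rw [← show M.policyLevels ε π r = e' from hr, M.policyLevels_eq_correct_iff,
      ← sub_nonneg] at hc
    simpa using M.expert_le_of_add_le hβ hc
  by_cases hb : π s ∈ K
  · exfalso
    have hne : ({r | M.policyLevels ε π r = e}).Nonempty := by
      by_contra h
      rw [Set.not_nonempty_iff_eq_empty] at h
      simp [h] at hpe
    obtain ⟨r, hr⟩ := hne
    have h3 : e (s, π s) = Level.notCorrect := by simpa [K] using hb
    have h4 : e (s, π s) = Level.correct := by
      rw [← show M.policyLevels ε π r = e from hr]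
      exact M.policyLevels_eq_correct_iff.2 le_rfl
    simp [h3] at h4
  have hKn : (K.card : ℝ) + 1 ≤ n := by
    have : K.card < Fintype.card A :=
      Finset.card_lt_univ_of_notMem hb
    simp only [n]
    exact_mod_cast this
  have hK0 : (0 : ℝ) ≤ K.card := Nat.cast_nonneg _
  have hosc : ∀ d : Demo S A T, |φ (d 0).2 - (1 - K.card) / 2| ≤ n / 2 := by
    intro d
    simp only [φ]
    rw [abs_le]
    by_cases h3 : (d 0).2 ∈ K
    · have h4 : (d 0).2 ≠ π s := fun h => hb (h ▸ h3)
      rw [if_pos h3, if_neg h4]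
      constructor <;> linarith
    · rw [if_neg h3]
      split_ifs <;> constructor <;> linarith
  have hmain := sub_le_mul_condDist_add (q := q) (y := e) (z := e') (by rw [hqsum]; exact hpe)
    (by rw [hqsum]; exact hpe') hosc
  have h3 : κ / n ≤ (∑ d, φ (d 0).2 * q d e) / ∑ d, q d e := by
    rw [le_div_iff₀ (by rw [hqsum]; exact hpe)]
    exact h1
  have h4 : (∑ d, φ (d 0).2 * q d e') / ∑ d, q d e' ≤ 0 :=
    div_nonpos_of_nonpos_of_nonneg h2 (by rw [hqsum]; exact hpe'.le)
  have h5 : κ / n ≤ n / 2 * (condDist q e + condDist q e') := by linarith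
  calc 2 * κ / n ^ 2 = 2 / n * (κ / n) := by field_simp
    _ ≤ 2 / n * (n / 2 * (condDist q e + condDist q e')) :=
        mul_le_mul_of_nonneg_left h5 (by positivity)
    _ = _ := by field_simp

/-- If the regret of the policy is large with posterior probability more than `δ`, then some query
is informative about the levels of this policy. -/
theorem exists_eigMin_le_mutualInfo (hA : 2 ≤ Fintype.card A) {β ε δ : ℝ} (hβ : 0 < β)
    (hε : 0 < ε) (hδ : 0 < δ) (ν : Measure (Reward S A)) [IsProbabilityMeasure ν] (T : ℕ)
    (π : S → A)
    (hopt : ∀ s, 1 / (Fintype.card A : ℝ) ≤ ν.real {r | M.IsOptAction r s (π s)})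
    (hreg : δ ≤ ν.real {r | ε ≤ M.regret r π}) :
    ∃ s, eigMin M β ε δ ≤ mutualInfo (fun (d : Demo S A T) e =>
      ∫ r in {r | M.policyLevels ε π r = e}, M.demoProb β r s d ∂ν) := by
  have : Nonempty A := Fintype.card_pos_iff.1 (by omega)
  have := M.nonempty_state
  have hN : 0 < (Fintype.card S : ℝ) := by exact_mod_cast Fintype.card_pos
  obtain ⟨s, hs⟩ : ∃ s, δ / Fintype.card S ≤
      ν.real {r | ∃ a, M.policyLevels ε π r (s, a) = Level.notCorrect} := by
    by_contra! hc
    have hsub : {r | ε ≤ M.regret r π} ⊆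
        ⋃ s, {r | ∃ a, M.policyLevels ε π r (s, a) = Level.notCorrect} := by
      intro r hr
      obtain ⟨s, a, h⟩ := M.exists_immediate_regret_of_le_regret hr
      exact Set.mem_iUnion.2 ⟨s, a, (M.policyLevels_eq_notCorrect_iff hε).2 h⟩
    have h1 := (measureReal_mono (μ := ν) hsub).trans (measureReal_iUnion_fintype_le _)
    have h2 := Finset.sum_lt_sum_of_nonempty (s := Finset.univ) Finset.univ_nonempty
      fun s _ => hc s
    rw [Finset.sum_const, Finset.card_univ, nsmul_eq_mul, mul_div_cancel₀ _ hN.ne'] at h2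
    linarith
  refine ⟨s, ?_⟩
  set q : Demo S A T → (S × A → Level) → ℝ := fun d e =>
    ∫ r in {r | M.policyLevels ε π r = e}, M.demoProb β r s d ∂ν
  have hqsum : ∀ e, ∑ d, q d e = ν.real {r | M.policyLevels ε π r = e} := fun e =>
    M.sum_setIntegral_demoProb β ν T s _
  have hfib := sum_measureReal_fiber ν (f := M.policyLevels ε π)
    (M.measurableSet_policyLevels_eq ε π)
  set F : Finset (S × A → Level) := Finset.univ.filter fun e => ∃ a, e (s, a) = Level.notCorrect
  set G : Finset (S × A → Level) := Finset.univ.filter fun e => ∀ a, e (s, a) = Level.correct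
  have hFG : Disjoint F G := by
    refine Finset.disjoint_left.2 fun e h1 h2 => ?_
    obtain ⟨a, ha⟩ := (Finset.mem_filter.1 h1).2
    simp [(Finset.mem_filter.1 h2).2 a] at ha
  have hγ := M.disc_lt_one
  have hκ : 0 < 1 - Real.exp (-(β * (1 - M.disc) * ε)) := by
    rw [sub_pos, Real.exp_lt_one_iff, neg_lt_zero]
    have : 0 < 1 - M.disc := by linarith
    positivity
  set κ := 1 - Real.exp (-(β * (1 - M.disc) * ε)) with hκdef
  set n : ℝ := (Fintype.card A : ℝ) with hndef
  have hn : 2 ≤ n := by simp only [hndef]; exact_mod_cast hA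
  have hmain := half_mul_sq_le_mutualInfo (q := q)
    (fun d e => integral_nonneg fun r => M.demoProb_nonneg β r s d)
    (by
      rw [Finset.sum_comm]
      simp_rw [hqsum]
      rw [hfib]
      simp) hFG (g := 2 * κ / n ^ 2) (by positivity)
    (fun e he e' he' hpe hpe' => M.le_condDist_add_condDist hβ hε ν T π s
      (Finset.mem_filter.1 he).2 (Finset.mem_filter.1 he').2 (hqsum e ▸ hpe) (hqsum e' ▸ hpe'))
  refine le_trans ?_ hmain
  simp_rw [hqsum]
  rw [hfib F, hfib G]
  have hU : δ / Fintype.card S ≤ ν.real {r | M.policyLevels ε π r ∈ F} := by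
    simpa [F] using hs
  have hV : 1 / n ≤ ν.real {r | M.policyLevels ε π r ∈ G} := by
    have := hopt s
    simpa [G, M.policyLevels_eq_correct_iff, IsOptAction] using this
  have hUV := mul_le_mul hU hV (by positivity) (by positivity)
  have hstep : 1 / 2 * (δ / Fintype.card S * (1 / n)) * (2 * κ / n ^ 2) ^ 2 ≤
      1 / 2 * (ν.real {r | M.policyLevels ε π r ∈ F} * ν.real {r | M.policyLevels ε π r ∈ G}) *
        (2 * κ / n ^ 2) ^ 2 := by
    gcongr
  refine le_trans ?_ hstep
  unfold eigMin
  rw [← hκdef, ← hndef]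
  have hm : 0 < n - 1 := by linarith
  have h8 : n ^ 3 ≤ 8 * (n - 1) ^ 3 := by
    have := pow_le_pow_left₀ (by linarith) (by linarith : n ≤ 2 * (n - 1)) 3
    rw [mul_pow] at this
    linarith
  have hn0 : 0 < n := by linarith
  calc δ * κ ^ 2 / (4 * n ^ 2 * (n - 1) ^ 3 * Fintype.card S)
      = 2 * δ * κ ^ 2 / (n ^ 2 * Fintype.card S * (8 * (n - 1) ^ 3)) := by
        field_simp
        norm_num
    _ ≤ 2 * δ * κ ^ 2 / (n ^ 2 * Fintype.card S * n ^ 3) := by gcongr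
    _ = _ := by
        field_simp

end MDP

/-! ### The posterior along the learning process -/

theorem history_succ {S A Ω : Type*} {T : ℕ} (demo : ℕ → Ω → Demo S A T) (n : ℕ) (ω : Ω) :
    history demo (n + 1) ω = history demo n ω ++ [demo n ω] := by
  unfold history
  rw [List.ofFn_succ', List.concat_eq_append]
  simp

section Learning

variable {S A : Type*} [Fintype S] [DecidableEq S] [Fintype A] {M : MDP S A}

theorem MDP.measurable_dataLikelihood (β : ℝ) {T : ℕ} (D : List (Demo S A T)) :
    Measurable fun r => M.dataLikelihood β r D := by
  unfold MDP.dataLikelihood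
  induction D with
  | nil => simp
  | cons d D ih =>
    simp only [List.map_cons, List.prod_cons]
    exact (M.measurable_likelihood β d).mul ih

theorem MDP.dataLikelihood_append_singleton (β : ℝ) {T : ℕ} (r : Reward S A)
    (D : List (Demo S A T)) (d : Demo S A T) :
    M.dataLikelihood β r (D ++ [d]) = M.dataLikelihood β r D * M.likelihood β r d := by
  simp [MDP.dataLikelihood]

theorem MDP.dataLikelihood_nonneg (β : ℝ) {T : ℕ} (r : Reward S A) (D : List (Demo S A T)) :
    0 ≤ M.dataLikelihood β r D := by
  refine List.prod_nonneg fun x hx => ?_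
  obtain ⟨d, _, rfl⟩ := List.mem_map.1 hx
  exact M.likelihood_nonneg β r d

theorem MDP.posterior_isOptAction_ge (hA : 2 ≤ Fintype.card A) {β : ℝ}
    {μ : Measure (Reward S A)} {T : ℕ} {app : List (Demo S A T) → S → A}
    (happ : M.IsApprenticeRule β μ app) (D : List (Demo S A T))
    [IsProbabilityMeasure (M.posterior β μ D)] (s : S) :
    1 / (Fintype.card A : ℝ) ≤ (M.posterior β μ D).real {r | M.IsOptAction r s (app D s)} := by
  have : Nonempty A := Fintype.card_pos_iff.1 (by omega)
  have hn : 0 < (Fintype.card A : ℝ) := by exact_mod_cast Fintype.card_pos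
  rw [div_le_iff₀ hn]
  have h1 : (M.posterior β μ D).real (⋃ a, {r | M.IsOptAction r s a}) = 1 := by
    have hU : ⋃ a, {r | M.IsOptAction r s a} = Set.univ :=
      Set.iUnion_eq_univ_iff.2 fun r => M.exists_isOptAction r s
    rw [hU]
    simp
  rw [← h1]
  refine (measureReal_iUnion_fintype_le _).trans ?_
  refine (Finset.sum_le_card_nsmul _ _ _ fun a _ => happ D s a).trans (le_of_eq ?_)
  rw [nsmul_eq_mul, Finset.card_univ, mul_comm]

theorem numSteps_le_tsum (M : MDP S A) (β ε δ : ℝ) (μ : Measure (Reward S A)) {T : ℕ}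
    {Ω : Type*} (demo : ℕ → Ω → Demo S A T) (ω : Ω) :
    numSteps M β ε δ μ demo ω ≤
      ∑' n, Set.indicator {ω | ¬ M.PAC β ε δ μ (history demo n ω)} (fun _ => (1 : ℝ≥0∞)) ω := by
  classical
  by_cases hex : ∃ n, M.PAC β ε δ μ (history demo n ω)
  · refine (iInf₂_le (Nat.find hex) (Nat.find_spec hex)).trans ?_
    refine le_trans (le_of_eq ?_) (ENNReal.sum_le_tsum (Finset.range (Nat.find hex)))
    rw [Finset.sum_congr rfl fun n hn => Set.indicator_of_mem
      (show ω ∈ {ω | ¬ M.PAC β ε δ μ (history demo n ω)} from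
        Nat.find_min hex (Finset.mem_range.1 hn)) _]
    simp
  · push Not at hex
    have : ∀ n, Set.indicator {ω | ¬ M.PAC β ε δ μ (history demo n ω)}
        (fun _ => (1 : ℝ≥0∞)) ω = 1 := fun n => Set.indicator_of_mem (hex n) _
    simp_rw [this]
    rw [ENNReal.tsum_const_eq_top_of_ne_zero one_ne_zero]
    exact le_top

namespace IsLearningProcess

variable {β : ℝ} {μ : Measure (Reward S A)} {T : ℕ} {query : List (Demo S A T) → S} {Ω : Type*}
  [MeasurableSpace Ω] {P : Measure Ω} {R : Ω → Reward S A} {demo : ℕ → Ω → Demo S A T}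

theorem measurableSet_history (h : IsLearningProcess M β μ query P R demo) (n : ℕ)
    (D : List (Demo S A T)) : MeasurableSet {ω | history demo n ω = D} := by
  induction n generalizing D with
  | zero => simp [history]
  | succ n ih =>
    rcases D.eq_nil_or_concat' with rfl | ⟨D, d, rfl⟩
    · simp [history_succ]
    · simp_rw [history_succ, List.append_singleton_inj]
      exact (ih D).inter (h.measurable_demo n d)

/-- The joint law of reward and next demonstration, through the law of the reward on the event that
the data are `D`. -/
theorem measure_demo_eq (h : IsLearningProcess M β μ query P R demo) (n : ℕ)
    {B : Set (Reward S A)} (hB : MeasurableSet B) (D : List (Demo S A T)) (d : Demo S A T) :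
    P {ω | R ω ∈ B ∧ history demo n ω = D ∧ demo n ω = d} =
      ∫⁻ r in B, ENNReal.ofReal (M.demoProb β r (query D) d)
        ∂((P.restrict {ω | history demo n ω = D}).map R) := by
  rw [h.demo_law n B D d hB, setLIntegral_map hB
    (M.measurable_demoProb β (query D) d).ennreal_ofReal h.measurable_reward,
    Measure.restrict_restrict (h.measurable_reward hB)]
  rfl

/-- On the event that the data are `D`, the reward is distributed with density proportional to the
likelihood of `D`, unless `D` contradicts the query rule. -/
theorem map_restrict_history (h : IsLearningProcess M β μ query P R demo) (n : ℕ)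
    (D : List (Demo S A T)) :
    (P.restrict {ω | history demo n ω = D}).map R = 0 ∨
      (P.restrict {ω | history demo n ω = D}).map R =
        μ.withDensity fun r => ENNReal.ofReal (M.dataLikelihood β r D) := by
  induction n generalizing D with
  | zero =>
    by_cases hD : D = []
    · right
      simp [hD, history, h.reward_law, MDP.dataLikelihood]
    · left
      simp [history, Ne.symm hD]
  | succ n ih =>
    rcases D.eq_nil_or_concat' with rfl | ⟨D, d, rfl⟩
    · left
      simp [history_succ]
    have hstep : (P.restrict {ω | history demo (n + 1) ω = D ++ [d]}).map R =
        ((P.restrict {ω | history demo n ω = D}).map R).withDensity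
          fun r => ENNReal.ofReal (M.demoProb β r (query D) d) := by
      refine Measure.ext fun B hB => ?_
      rw [withDensity_apply _ hB, ← h.measure_demo_eq n hB, Measure.map_apply h.measurable_reward hB,
        Measure.restrict_apply (h.measurable_reward hB)]
      congr 1
      ext ω
      simp only [history_succ, List.append_singleton_inj]
      rfl
    rw [hstep]
    rcases ih D with h0 | h1
    · left
      rw [h0]
      simp
    · rw [h1]
      by_cases hd : (d 0).1 = query D
      · right
        simp_rw [MDP.demoProb, if_pos hd, M.dataLikelihood_append_singleton,
          ENNReal.ofReal_mul (M.dataLikelihood_nonneg β _ D)]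
        exact (withDensity_mul _ (M.measurable_dataLikelihood β D).ennreal_ofReal
          (M.measurable_likelihood β d).ennreal_ofReal).symm
      · left
        simp [MDP.demoProb, if_neg hd]

/-- Bayes' rule: the posterior is the conditional law of the reward given the data. -/
theorem posterior_eq (h : IsLearningProcess M β μ query P R demo) {n : ℕ}
    {D : List (Demo S A T)} (hD : P {ω | history demo n ω = D} ≠ 0) :
    M.posterior β μ D = (P {ω | history demo n ω = D})⁻¹ •
      (P.restrict {ω | history demo n ω = D}).map R := by
  have hmass : (P.restrict {ω | history demo n ω = D}).map R Set.univ =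
      P {ω | history demo n ω = D} := by
    rw [Measure.map_apply h.measurable_reward .univ]
    simp
  rcases h.map_restrict_history n D with h0 | h1
  · rw [h0] at hmass
    exact absurd hmass.symm (by simpa using hD)
  · rw [← hmass, h1, withDensity_apply _ .univ, Measure.restrict_univ]
    rfl

variable [IsProbabilityMeasure P]

theorem isProbabilityMeasure_posterior (h : IsLearningProcess M β μ query P R demo) {n : ℕ}
    {D : List (Demo S A T)} (hD : P {ω | history demo n ω = D} ≠ 0) :
    IsProbabilityMeasure (M.posterior β μ D) := by
  constructor
  rw [h.posterior_eq hD, Measure.smul_apply, Measure.map_apply h.measurable_reward .univ]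
  simp [ENNReal.inv_mul_cancel hD (measure_ne_top _ _)]

theorem measureReal_demo_eq [Nonempty A] (h : IsLearningProcess M β μ query P R demo) {n : ℕ}
    {D : List (Demo S A T)} (hD : P {ω | history demo n ω = D} ≠ 0) {B : Set (Reward S A)}
    (hB : MeasurableSet B) (d : Demo S A T) :
    P.real {ω | R ω ∈ B ∧ history demo n ω = D ∧ demo n ω = d} =
      P.real {ω | history demo n ω = D} *
        ∫ r in B, M.demoProb β r (query D) d ∂(M.posterior β μ D) := by
  have := h.isProbabilityMeasure_posterior hD
  have hmap : (P.restrict {ω | history demo n ω = D}).map R =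
      P {ω | history demo n ω = D} • M.posterior β μ D := by
    rw [h.posterior_eq hD, smul_smul, ENNReal.mul_inv_cancel hD (measure_ne_top _ _), one_smul]
  rw [measureReal_def, h.measure_demo_eq n hB, hmap, Measure.restrict_smul, lintegral_smul_measure,
    smul_eq_mul, ENNReal.toReal_mul, measureReal_def,
    integral_eq_lintegral_of_nonneg_ae (.of_forall fun r => M.demoProb_nonneg β r _ d)
      (M.measurable_demoProb β _ d).aestronglyMeasurable]

/-! ### The expected decrease of the entropy -/

/-- The probability that the data after `n` steps are `D` and the levels of the reward are `e`. -/
noncomputable def _root_.ActiveIRL.levelMass (M : MDP S A) (ε : ℝ) (P : Measure Ω)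
    (R : Ω → Reward S A) (demo : ℕ → Ω → Demo S A T) (n : ℕ) (D : List (Demo S A T))
    (e : S × A × A → Level) : ℝ :=
  P.real {ω | R ω ∈ {r | M.regretLevels ε r = e} ∧ history demo n ω = D}

theorem levelMass_eq_sum (h : IsLearningProcess M β μ query P R demo) (ε : ℝ) (n : ℕ)
    (D : List (Demo S A T)) (e : S × A × A → Level) :
    levelMass M ε P R demo n D e = ∑ d, levelMass M ε P R demo (n + 1) (D ++ [d]) e := by
  have hf := sum_measureReal_fiber
    (P.restrict {ω | R ω ∈ {r | M.regretLevels ε r = e} ∧ history demo n ω = D})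
    (h.measurable_demo n) Finset.univ
  simp_rw [measureReal_restrict_apply (h.measurable_demo n _)] at hf
  simp only [Finset.mem_univ] at hf
  unfold levelMass
  symm
  convert hf using 1
  · refine Finset.sum_congr rfl fun d _ => ?_
    congr 1
    ext ω
    simp only [history_succ, List.append_singleton_inj, Set.mem_ofPred_eq, Set.mem_inter_iff]
    tauto
  · simp

variable [DecidableEq A]

theorem sum_levelMass (h : IsLearningProcess M β μ query P R demo) (ε : ℝ) (n : ℕ)
    (D : List (Demo S A T)) :
    ∑ e, levelMass M ε P R demo n D e = P.real {ω | history demo n ω = D} := by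
  have hL : ∀ e, MeasurableSet {ω | M.regretLevels ε (R ω) = e} := fun e =>
    h.measurable_reward (M.measurableSet_regretLevels_eq ε e)
  have hf := sum_measureReal_fiber (P.restrict {ω | history demo n ω = D}) hL Finset.univ
  simp_rw [measureReal_restrict_apply (hL _)] at hf
  exact Eq.trans rfl (hf.trans (by simp))

variable {app : List (Demo S A T) → S → A}

/-- One query decreases the expected entropy of the levels by at least `EIG_min`, unless the PAC
condition holds. -/
theorem massEntropy_sub_ge (h : IsLearningProcess M β μ query P R demo)
    (hA : 2 ≤ Fintype.card A) {ε δ : ℝ} (hβ : 0 < β) (hε : 0 < ε) (hδ : 0 < δ)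
    (happ : M.IsApprenticeRule β μ app) (hquery : M.IsQueryRule β ε μ app query) (n : ℕ)
    (D : List (Demo S A T)) {c : ℝ} (hc : c = 0 ∨ c = 1 ∧ ¬ M.PAC β ε δ μ D) :
    eigMin M β ε δ * (c * P.real {ω | history demo n ω = D}) ≤
      massEntropy (levelMass M ε P R demo n D) -
        ∑ d, massEntropy (levelMass M ε P R demo (n + 1) (D ++ [d])) := by
  have : Nonempty A := Fintype.card_pos_iff.1 (by omega)
  by_cases hD : P {ω | history demo n ω = D} = 0
  · have hw : P.real {ω | history demo n ω = D} = 0 := by simp [measureReal_def, hD]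
    have h0 : ∀ e, levelMass M ε P R demo n D e = 0 := fun e =>
      (Finset.sum_eq_zero_iff_of_nonneg fun e _ => measureReal_nonneg).1
        ((h.sum_levelMass ε n D).trans hw) e (Finset.mem_univ e)
    have h1 : ∀ d e, levelMass M ε P R demo (n + 1) (D ++ [d]) e = 0 := fun d e =>
      (Finset.sum_eq_zero_iff_of_nonneg fun e _ => measureReal_nonneg).1
        ((h.levelMass_eq_sum ε n D e).symm.trans (h0 e)) d (Finset.mem_univ d)
    simp [hw, massEntropy, h0, h1]
  have hprob := h.isProbabilityMeasure_posterior hD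
  have hw : 0 < P.real {ω | history demo n ω = D} :=
    ENNReal.toReal_pos hD (measure_ne_top _ _)
  set q : Demo S A T → (S × A × A → Level) → ℝ := fun d e =>
    ∫ r in {r | M.regretLevels ε r = e}, M.demoProb β r (query D) d ∂(M.posterior β μ D)
  have hq : ∀ d e, 0 ≤ q d e := fun d e => integral_nonneg fun r => M.demoProb_nonneg β r _ d
  have hq1 : ∑ d, ∑ e, q d e = 1 := by
    rw [Finset.sum_comm]
    simp_rw [q, M.sum_setIntegral_demoProb β]
    rw [sum_measureReal_fiber _ (M.measurableSet_regretLevels_eq ε)]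
    simp
  have hchain := mul_mutualInfo_eq_massEntropy_sub hw hq hq1
    (v := fun d e => levelMass M ε P R demo (n + 1) (D ++ [d]) e) (fun d e => by
      rw [← h.measureReal_demo_eq hD (M.measurableSet_regretLevels_eq ε e) d]
      unfold levelMass
      simp_rw [history_succ, List.append_singleton_inj])
  simp_rw [← h.levelMass_eq_sum ε n D] at hchain
  rw [← hchain]
  rcases hc with rfl | ⟨rfl, hpac⟩
  · rw [zero_mul, mul_zero]
    refine mul_nonneg hw.le (le_trans ?_ (half_sum_sq_condDist_le_mutualInfo hq hq1))
    exact mul_nonneg (by norm_num) (Finset.sum_nonneg fun e _ =>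
      mul_nonneg (Finset.sum_nonneg fun d _ => hq d e) (sq_nonneg _))
  · rw [one_mul, mul_comm]
    refine mul_le_mul_of_nonneg_left ?_ hw.le
    have hreg : δ ≤ (M.posterior β μ D).real {r | ε ≤ M.regret r (app D)} := by
      by_contra hcon
      exact hpac ⟨app D, (not_le.1 hcon).le⟩
    obtain ⟨s, hs⟩ := M.exists_eigMin_le_mutualInfo hA hβ hε hδ (M.posterior β μ D) T (app D)
      (M.posterior_isOptAction_ge hA happ D) hreg
    exact hs.trans ((hquery D s).trans (M.mutualInfo_policyLevels_le β _ ε T (query D) (app D)))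

/-- The expected entropy of the levels given the data of `n` steps. -/
noncomputable def _root_.ActiveIRL.expectedEntropy (M : MDP S A) (ε : ℝ) (P : Measure Ω)
    (R : Ω → Reward S A) (demo : ℕ → Ω → Demo S A T) (n : ℕ) : ℝ :=
  ∑ D : Fin n → Demo S A T, massEntropy (levelMass M ε P R demo n (List.ofFn D))

theorem expectedEntropy_sub_ge (h : IsLearningProcess M β μ query P R demo)
    (hA : 2 ≤ Fintype.card A) {ε δ : ℝ} (hβ : 0 < β) (hε : 0 < ε) (hδ : 0 < δ)
    (happ : M.IsApprenticeRule β μ app) (hquery : M.IsQueryRule β ε μ app query) (n : ℕ) :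
    eigMin M β ε δ * P.real {ω | ¬ M.PAC β ε δ μ (history demo n ω)} ≤
      expectedEntropy M ε P R demo n - expectedEntropy M ε P R demo (n + 1) := by
  classical
  have hvec : ∀ D : Fin n → Demo S A T,
      {ω | (fun i : Fin n => demo i ω) = D} = {ω | history demo n ω = List.ofFn D} := by
    intro D
    ext ω
    simp only [history, Set.mem_ofPred_eq, List.ofFn_inj]
  have hf := sum_measureReal_fiber P (f := fun ω (i : Fin n) => demo i ω)
    (fun D => by rw [hvec]; exact h.measurableSet_history n _)
    (Finset.univ.filter fun D => ¬ M.PAC β ε δ μ (List.ofFn D))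
  simp only [Finset.mem_filter, Finset.mem_univ, true_and, hvec] at hf
  have hset : P.real {ω | ¬ M.PAC β ε δ μ (history demo n ω)} =
      ∑ D : Fin n → Demo S A T, (if ¬ M.PAC β ε δ μ (List.ofFn D) then (1 : ℝ) else 0) *
        P.real {ω | history demo n ω = List.ofFn D} := by
    simp_rw [ite_mul, one_mul, zero_mul]
    rw [← Finset.sum_filter, hf]
    rfl
  have hsucc : expectedEntropy M ε P R demo (n + 1) = ∑ D : Fin n → Demo S A T,
      ∑ d, massEntropy (levelMass M ε P R demo (n + 1) (List.ofFn D ++ [d])) := by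
    unfold expectedEntropy
    rw [← (Fin.snocEquiv fun _ : Fin (n + 1) => Demo S A T).sum_comp, Fintype.sum_prod_type_right]
    refine Finset.sum_congr rfl fun D _ => Finset.sum_congr rfl fun d _ => ?_
    rw [List.ofFn_succ', List.concat_eq_append]
    simp [Fin.snocEquiv]
  rw [hset, hsucc, expectedEntropy, ← Finset.sum_sub_distrib, Finset.mul_sum]
  refine Finset.sum_le_sum fun D _ =>
    h.massEntropy_sub_ge hA hβ hε hδ happ hquery n (List.ofFn D) ?_
  split_ifs with hpac
  exacts [Or.inl rfl, Or.inr ⟨rfl, hpac⟩]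

theorem expectedEntropy_zero (h : IsLearningProcess M β μ query P R demo) (ε : ℝ) :
    expectedEntropy M ε P R demo 0 =
      entropy (fun e => μ.real {r | M.regretLevels ε r = e}) := by
  have : IsProbabilityMeasure μ :=
    h.reward_law ▸ Measure.isProbabilityMeasure_map h.measurable_reward.aemeasurable
  have hmass : levelMass M ε P R demo 0 [] = fun e => μ.real {r | M.regretLevels ε r = e} := by
    funext e
    rw [← h.reward_law, map_measureReal_apply h.measurable_reward
      (M.measurableSet_regretLevels_eq ε e)]
    simp [levelMass, history]
  unfold expectedEntropy
  simp only [Finset.univ_unique, List.ofFn_zero, Finset.sum_singleton, hmass]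
  refine massEntropy_eq_entropy ?_
  rw [sum_measureReal_fiber _ (M.measurableSet_regretLevels_eq ε)]
  simp

end IsLearningProcess

variable [DecidableEq A]

theorem entropy_regretLevels_le (M : MDP S A) (ε : ℝ) (μ : Measure (Reward S A))
    [IsProbabilityMeasure μ] :
    entropy (fun e => μ.real {r | M.regretLevels ε r = e}) ≤
      Real.log 3 * (Fintype.card S : ℝ) * (Fintype.card A : ℝ) ^ 2 := by
  refine (entropy_le_log_card (fun e => measureReal_nonneg) ?_).trans (le_of_eq ?_)
  · rw [sum_measureReal_fiber _ (M.measurableSet_regretLevels_eq ε)]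
    simp
  · have h3 : Fintype.card Level = 3 := rfl
    rw [Fintype.card_fun, h3, Fintype.card_prod, Fintype.card_prod]
    push_cast
    rw [Real.log_pow]
    push_cast
    ring

/-- The expected number of steps until the PAC condition is met. -/
theorem IsLearningProcess.lintegral_numSteps_le {β : ℝ} {μ : Measure (Reward S A)}
    [IsProbabilityMeasure μ] {T : ℕ} {query : List (Demo S A T) → S} {Ω : Type*}
    [MeasurableSpace Ω] {P : Measure Ω} [IsProbabilityMeasure P] {R : Ω → Reward S A}
    {demo : ℕ → Ω → Demo S A T} {app : List (Demo S A T) → S → A}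
    (h : IsLearningProcess M β μ query P R demo)
    (hA : 2 ≤ Fintype.card A) {ε δ : ℝ} (hβ : 0 < β) (hε : 0 < ε) (hδ : 0 < δ)
    (happ : M.IsApprenticeRule β μ app) (hquery : M.IsQueryRule β ε μ app query)
    (heig : 0 < eigMin M β ε δ) :
    ∫⁻ ω, numSteps M β ε δ μ demo ω ∂P ≤ ENNReal.ofReal
      (entropy (fun e => μ.real {r | M.regretLevels ε r = e}) / eigMin M β ε δ) := by
  have hmeas : ∀ n, MeasurableSet {ω | ¬ M.PAC β ε δ μ (history demo n ω)} := by
    intro n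
    have : {ω | ¬ M.PAC β ε δ μ (history demo n ω)} =
        ⋃ D ∈ {D : List (Demo S A T) | ¬ M.PAC β ε δ μ D}, {ω | history demo n ω = D} := by
      ext ω
      simp
    rw [this]
    exact MeasurableSet.biUnion (Set.to_countable _) fun D _ => h.measurableSet_history n D
  refine (lintegral_mono fun ω => numSteps_le_tsum M β ε δ μ demo ω).trans ?_
  rw [lintegral_tsum fun n => (measurable_const.indicator (hmeas n)).aemeasurable]
  simp_rw [lintegral_indicator_const (hmeas _), one_mul]
  refine ENNReal.tsum_le_of_sum_range_le fun N => ?_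
  have hreal : ∑ n ∈ Finset.range N, P.real {ω | ¬ M.PAC β ε δ μ (history demo n ω)} ≤
      entropy (fun e => μ.real {r | M.regretLevels ε r = e}) / eigMin M β ε δ := by
    rw [le_div_iff₀ heig, mul_comm, Finset.mul_sum, ← h.expectedEntropy_zero ε]
    refine (Finset.sum_le_sum fun n _ =>
      h.expectedEntropy_sub_ge hA hβ hε hδ happ hquery n).trans ?_
    rw [Finset.sum_range_sub']
    refine sub_le_self _ (Finset.sum_nonneg fun D _ => massEntropy_nonneg fun e => ?_)
    exact measureReal_nonneg
  refine le_trans (le_of_eq ?_) (ENNReal.ofReal_le_ofReal hreal)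
  rw [ENNReal.ofReal_sum_of_nonneg fun n _ => measureReal_nonneg]
  exact Finset.sum_congr rfl fun n _ => (ofReal_measureReal (measure_ne_top _ _)).symm

end Learning

end ActiveIRL

theorem mainTheorem3 {S A : Type*} [Fintype S] [DecidableEq S] [Fintype A] [DecidableEq A]
    (M : ActiveIRL.MDP S A) (hA : 2 ≤ Fintype.card A)
    (β ε δ : ℝ) (hβ : 0 < β) (hε : 0 < ε) (hδ : 0 < δ) (hδ' : δ ≤ 1 / 2)
    (μ : MeasureTheory.Measure (ActiveIRL.Reward S A)) [MeasureTheory.IsProbabilityMeasure μ]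
    (T : ℕ)
    (app : List (ActiveIRL.Demo S A T) → S → A) (happ : M.IsApprenticeRule β μ app)
    (query : List (ActiveIRL.Demo S A T) → S) (hquery : M.IsQueryRule β ε μ app query)
    {Ω : Type*} [MeasurableSpace Ω] (P : MeasureTheory.Measure Ω)
    [MeasureTheory.IsProbabilityMeasure P]
    (R : Ω → ActiveIRL.Reward S A) (demo : ℕ → Ω → ActiveIRL.Demo S A T)
    (hproc : ActiveIRL.IsLearningProcess M β μ query P R demo) :
    -- the expected number of steps
    ∫⁻ ω, ActiveIRL.numSteps M β ε δ μ demo ω ∂P ≤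
        ENNReal.ofReal (Real.log 3 * (Fintype.card S : ℝ) * (Fintype.card A : ℝ) ^ 2 /
          ActiveIRL.eigMin M β ε δ) ∧
    -- the explicit form of the bound
    Real.log 3 * (Fintype.card S : ℝ) * (Fintype.card A : ℝ) ^ 2 / ActiveIRL.eigMin M β ε δ =
        4 * Real.log 3 * (Fintype.card A : ℝ) ^ 4 * ((Fintype.card A : ℝ) - 1) ^ 3 *
          (Fintype.card S : ℝ) ^ 2 / (δ * (1 - Real.exp (-(β * (1 - M.disc) * ε))) ^ 2) ∧
    -- a weaker explicit bound
    4 * Real.log 3 * (Fintype.card A : ℝ) ^ 4 * ((Fintype.card A : ℝ) - 1) ^ 3 *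
          (Fintype.card S : ℝ) ^ 2 / (δ * (1 - Real.exp (-(β * (1 - M.disc) * ε))) ^ 2) ≤
        4 * Real.log 3 * (Fintype.card A : ℝ) ^ 4 * ((Fintype.card A : ℝ) - 1) ^ 3 *
          (Fintype.card S : ℝ) ^ 2 /
          (δ * Real.exp (-(β * (1 - M.disc) * ε)) *
            (1 - Real.exp (-(β * (1 - M.disc) * ε / 2))) ^ 2) ∧
    -- the entropy of the aggregate regret variable under the prior
    ActiveIRL.entropy (fun e => μ.real {r | M.regretLevels ε r = e}) ≤
        Real.log 3 * (Fintype.card S : ℝ) * (Fintype.card A : ℝ) ^ 2 := by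
  have hγ : 0 < 1 - M.disc := sub_pos.2 M.disc_lt_one
  have hx : 0 < β * (1 - M.disc) * ε := by positivity
  have : Nonempty S := M.nonempty_state
  have hS : 0 < (Fintype.card S : ℝ) := by exact_mod_cast Fintype.card_pos
  have hA2 : (2 : ℝ) ≤ Fintype.card A := by exact_mod_cast hA
  have hA0 : 0 < (Fintype.card A : ℝ) := by linarith
  have hA1 : 0 < (Fintype.card A : ℝ) - 1 := by linarith
  have hκ : 0 < 1 - Real.exp (-(β * (1 - M.disc) * ε)) := by
    rw [sub_pos, Real.exp_lt_one_iff, neg_lt_zero]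
    exact hx
  have hκ' : 0 < 1 - Real.exp (-(β * (1 - M.disc) * ε / 2)) := by
    rw [sub_pos, Real.exp_lt_one_iff, neg_lt_zero]
    positivity
  have heig : 0 < ActiveIRL.eigMin M β ε δ := by
    unfold ActiveIRL.eigMin
    positivity
  have hent := ActiveIRL.entropy_regretLevels_le M ε μ
  have hlog : 0 < Real.log 3 := Real.log_pos (by norm_num)
  refine ⟨(hproc.lintegral_numSteps_le hA hβ hε hδ happ hquery heig).trans
    (ENNReal.ofReal_le_ofReal (by gcongr)), ?_, ?_, hent⟩
  · unfold ActiveIRL.eigMin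
    field_simp
  · refine div_le_div_of_nonneg_left (by positivity) (by positivity) ?_
    rw [mul_assoc]
    refine mul_le_mul_of_nonneg_left ?_ hδ.le
    have hle : Real.exp (-(β * (1 - M.disc) * ε)) ≤ 1 :=
      Real.exp_le_one_iff.2 (neg_nonpos.2 hx.le)
    have hle' : Real.exp (-(β * (1 - M.disc) * ε)) ≤
        Real.exp (-(β * (1 - M.disc) * ε / 2)) :=
      Real.exp_le_exp.2 (by linarith)
    exact (mul_le_of_le_one_left (sq_nonneg _) hle).trans
      (pow_le_pow_left₀ hκ'.le (by linarith) 2)
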